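/- **Proposition (Energy conservation).** Let $d\in\{2,3\}$, let $\Omega\subset\mathbb R^d$ (the whole fluid–solid domain) and $S=\Omega^s_{\mathbf X}\subset\mathbb R^d$ (the reference domain of the solid) be bounded open sets, let $T>0$, and let $\rho^f,\rho^s,\mu^f,c_1$ be real constants, $\rho^\delta=\rho^s-\rho^f$. Write $A:B=\sum_{ij}A_{ij}B_{ij}$, $\mathrm D u=\nabla u+\nabla^T u$ and $$\Psi(F)=\frac{c_1}{2}\bigl(\operatorname{tr}(FF^T)-d\bigr)-c_1\ln(\det F).$$ Let $u_0$ be the initial velocity on $\Omega$ and $x_0:S\to\Omega$ the initial position of the solid. Let $(u,p)$, together with the deformations $x(t):S\to\Omega$ and $\Omega^s_t=x(t)(S)$, be a solution on $[0,T]$ of the one-field weak formulation with homogeneous Dirichlet data, that is: * $u\in L^2(0,T;H^1_0(\Omega)^d)\cap H^1(0,T;L^2(\Omega)^d)$, $u(0)=u_0$, and $p(t)\in L^2_0(\Omega)$ (square integrable with mean value zero) for a.e. $t$; * the maps $x(t)$, $t\in[0,T]$, are bi-Lipschitz onto their images with a constant independent of $t$, $x(0)=x_0$, $F(t)=\nabla_{\mathbf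 X}x(t)$ satisfies $J=\det F>0$ a.e., and the solid moves with the velocity $u$: $\partial_t x(t,\mathbf X)=U(t,\mathbf X):=u(t,x(t,\mathbf X))$, with $x, U\in H^1(0,T;L^2(S)^d)$; * for a.e. $t\in(0,T)$, for all $v\in H^1_0(\Omega)^d$ and all $q\in L^2(\Omega)$, $$\rho^f\!\int_\Omega \partial_t u\cdot v\,dx+\rho^f\!\int_\Omega (u\cdot\nabla)u\cdot v\,dx+\frac{\mu^f}{2}\int_\Omega \mathrm Du:\mathrm Dv\,dx-\int_\Omega p\,\nabla\!\cdot v\,dx$$ $$+\rho^\delta\!\int_S \partial_t U\cdot (v\circ x)\,d\mathbf X+c_1\!\int_S F:\nabla_{\mathbf X}(v\circ x)\,d\mathbf X-c_1\!\int_{\Omega^s_t}J^{-1}\,\nabla\!\cdot v\,dx=0,$$ $$-\int_\Omega q\,\nabla\!\cdot u\,dx=0 ,$$ where in the integral over $\Omega^s_t$ the function $J$ is evaluated at $x(t)^{-1}(x)$. Then for every $t\in[0,T]$ all the integrals below are finite, and, with $F_0=\nabla_{\mathbf X}x_0$, $$\frac{\rho^f}{2}\int_\Omega|u(t)|^2dx+\frac{\mu^f}{2}\int_0^t\!\!\int_\Omega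 \mathrm Du:\mathrm Du\,dx\,ds+\frac{\rho^\delta}{2}\int_S|u(t,x(t,\mathbf X))|^2d\mathbf X+\int_S\Psi(F(t))\,d\mathbf X$$ $$=\frac{\rho^f}{2}\int_\Omega|u_0|^2dx+\frac{\rho^\delta}{2}\int_S|u_0(x_0(\mathbf X))|^2d\mathbf X+\int_S\Psi(F_0)\,d\mathbf X .$$ In particular, if $u_0=0$ a.e. on $\Omega$ and $F_0=\mathbf I$ a.e. on $S$, then the left-hand side equals $0$. -/

import Mathlib

open MeasureTheory Set
open scoped ContDiff NNReal

noncomputable section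

/-- Points and vectors of `ℝ^d` with the Euclidean norm. -/
abbrev Vec (d : ℕ) : Type := EuclideanSpace ℝ (Fin d)

/-- Second order tensors on `ℝ^d`; the Jacobian of `f` at `y` is `fderiv ℝ f y`. -/
abbrev Ten (d : ℕ) : Type := Vec d →L[ℝ] Vec d

/-- The double contraction `A : B = ∑ᵢⱼ Aᵢⱼ Bᵢⱼ = tr (A Bᵀ)`, summed column by column. -/
def ddot {d : ℕ} (A B : Ten d) : ℝ :=
  ∑ j : Fin d, inner ℝ (A (EuclideanSpace.single j 1)) (B (EuclideanSpace.single j 1))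

/-- The trace of a tensor; applied to a gradient it gives the divergence. -/
def tr {d : ℕ} (A : Ten d) : ℝ := LinearMap.trace ℝ (Vec d) (A : Vec d →ₗ[ℝ] Vec d)

/-- `A + Aᵀ`; applied to a velocity gradient `∇u` it gives `D u`. -/
def symGrad {d : ℕ} (A : Ten d) : Ten d := A + ContinuousLinearMap.adjoint A

/-- The neo-Hookean energy density `Ψ(F) = (c₁/2) (tr (F Fᵀ) - d) - c₁ ln (det F)`. -/
def neoHookean {d : ℕ} (c₁ : ℝ) (F : Ten d) : ℝ :=
  c₁ / 2 * (tr (F ∘L ContinuousLinearMap.adjoint F) - d) - c₁ * Real.log F.det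

/-- `G` is the weak gradient of the vector field `f` on the open set `A`. -/
def HasWeakGrad {d : ℕ} (A : Set (Vec d)) (f : Vec d → Vec d) (G : Vec d → Ten d) : Prop :=
  LocallyIntegrableOn f A ∧ LocallyIntegrableOn G A ∧
    ∀ φ : Vec d → ℝ, ContDiff ℝ ∞ φ → HasCompactSupport φ → tsupport φ ⊆ A →
      ∀ e : Vec d, ∫ y in A, (fderiv ℝ φ y e) • f y = - ∫ y in A, φ y • (G y e)

/-- `v ∈ H¹(A)^d` with weak gradient `Dv`. -/
def MemH1 {d : ℕ} (A : Set (Vec d)) (v : Vec d → Vec d) (Dv : Vec d → Ten d) : Prop :=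
  MemLp v 2 (volume.restrict A) ∧ MemLp Dv 2 (volume.restrict A) ∧ HasWeakGrad A v Dv

/-- `v ∈ H¹₀(A)^d` with weak gradient `Dv`: `v` lies in the `H¹`-closure of the smooth vector
fields with compact support in `A`. -/
def MemH10 {d : ℕ} (A : Set (Vec d)) (v : Vec d → Vec d) (Dv : Vec d → Ten d) : Prop :=
  MemH1 A v Dv ∧
    ∀ ε : ℝ≥0, 0 < ε → ∃ φ : Vec d → Vec d,
      ContDiff ℝ ∞ φ ∧ HasCompactSupport φ ∧ tsupport φ ⊆ A ∧
      eLpNorm (fun y => v y - φ y) 2 (volume.restrict A) ≤ ε ∧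
      eLpNorm (fun y => Dv y - fderiv ℝ φ y) 2 (volume.restrict A) ≤ ε

/-- `f ∈ H¹(0, T; L²(A)^d)` with time derivative `f'`: both are square integrable and
`f(t) = f(0) + ∫₀ᵗ f'(s) ds` in `L²(A)^d` for every `t ∈ [0, T]`. -/
structure HasTimeDeriv {d : ℕ} (T : ℝ) (A : Set (Vec d)) (f f' : ℝ → Vec d → Vec d) : Prop where
  memLp_init : MemLp (f 0) 2 (volume.restrict A)
  memLp_deriv : MemLp (Function.uncurry f') 2
    ((volume.restrict (Ioc 0 T)).prod (volume.restrict A))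
  eq_add_integral : ∀ t ∈ Icc 0 T, ∀ᵐ y ∂(volume.restrict A),
    f t y = f 0 y + ∫ s in (0 : ℝ)..t, f' s y

/-- The data of the fluid-structure problem in `ℝ^d` on the time interval `[0, T]`: the fixed
bounded domain `Ω`, the bounded reference domain `S` of the solid, the densities of fluid and
solid, the viscosity `μf`, the neo-Hookean constant `c₁`, the initial velocity `u₀` on `Ω`, and the
initial position `x₀` of the solid as a function of the reference coordinates. -/
structure FSIProblem (d : ℕ) where
  Ω : Set (Vec d)
  S : Set (Vec d)
  T : ℝ
  ρf : ℝ
  ρs : ℝ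
  μf : ℝ
  c₁ : ℝ
  u₀ : Vec d → Vec d
  x₀ : Vec d → Vec d
  isOpen_Ω : IsOpen Ω
  isBounded_Ω : Bornology.IsBounded Ω
  isOpen_S : IsOpen S
  isBounded_S : Bornology.IsBounded S
  T_pos : 0 < T

/-- `ρ^δ = ρ^s - ρ^f`. -/
def FSIProblem.ρδ {d : ℕ} (P : FSIProblem d) : ℝ := P.ρs - P.ρf

/-- The left-hand side of the one-field momentum equation at one instant. Here `u, Du, ut, p` are
the velocity, its gradient, its Eulerian time derivative and the pressure on `Ω`; `x` is the
position of the solid as a function of the reference coordinates and `Ut` is the time derivative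
of the velocity along the solid particles, both on `S`; `v` is the test field, `Dv` its
gradient, and `DXv` the gradient of `v ∘ x` with respect to the reference coordinates.
The last integral is over the current solid domain `x(S)`. -/
def FSIProblem.momentum {d : ℕ} (P : FSIProblem d)
    (u : Vec d → Vec d) (Du : Vec d → Ten d) (ut : Vec d → Vec d) (p : Vec d → ℝ)
    (x : Vec d → Vec d) (Ut : Vec d → Vec d)
    (v : Vec d → Vec d) (Dv : Vec d → Ten d) (DXv : Vec d → Ten d) : ℝ :=
  P.ρf * (∫ y in P.Ω, inner ℝ (ut y) (v y))
    + P.ρf * (∫ y in P.Ω, inner ℝ (Du y (u y)) (v y))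
    + P.μf / 2 * (∫ y in P.Ω, ddot (symGrad (Du y)) (symGrad (Dv y)))
    - (∫ y in P.Ω, p y * tr (Dv y))
    + P.ρδ * (∫ X in P.S, inner ℝ (Ut X) (v (x X)))
    + P.c₁ * (∫ X in P.S, ddot (fderiv ℝ x X) (DXv X))
    - P.c₁ * (∫ y in x '' P.S, (fderiv ℝ x (Function.invFunOn x P.S y)).det⁻¹ * tr (Dv y))

/-- `(u, p, x)` solves the one-field weak formulation on `[0, T]` with homogeneous Dirichlet
data. `Du` is the weak spatial gradient of `u`, `ut` its Eulerian time derivative, and `Ut` the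
time derivative of the Lagrangian solid velocity `X ↦ u(t, x(t, X))`. The current solid domain
is `Ω_t^s = x(t, S)`. -/
structure FSIProblem.IsWeakSolution {d : ℕ} (P : FSIProblem d)
    (u : ℝ → Vec d → Vec d) (Du : ℝ → Vec d → Ten d) (ut : ℝ → Vec d → Vec d)
    (p : ℝ → Vec d → ℝ) (x : ℝ → Vec d → Vec d) (Ut : ℝ → Vec d → Vec d) : Prop where
  /-- initial velocity -/
  init_u : ∀ᵐ y ∂(volume.restrict P.Ω), u 0 y = P.u₀ y
  /-- initial position of the solid -/
  init_x : ∀ X ∈ P.S, x 0 X = P.x₀ X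
  /-- `u ∈ H¹(0, T; L²(Ω)^d)` -/
  timeDeriv_u : HasTimeDeriv P.T P.Ω u ut
  /-- `u ∈ L²(0, T; H¹₀(Ω)^d)` -/
  memLp_Du : MemLp (Function.uncurry Du) 2
    ((volume.restrict (Ioc 0 P.T)).prod (volume.restrict P.Ω))
  memH10_u : ∀ᵐ t ∂(volume.restrict (Ioc 0 P.T)), MemH10 P.Ω (u t) (Du t)
  /-- `p(t) ∈ L²₀(Ω)` -/
  memL20_p : ∀ᵐ t ∂(volume.restrict (Ioc 0 P.T)),
    MemLp (p t) 2 (volume.restrict P.Ω) ∧ ∫ y in P.Ω, p t y = 0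
  /-- the solid stays in `Ω` -/
  mapsTo_x : ∀ t ∈ Icc 0 P.T, MapsTo (x t) P.S P.Ω
  /-- the deformations of the solid are bi-Lipschitz, uniformly in time -/
  biLipschitz_x : ∃ K : ℝ≥0, ∀ t ∈ Icc 0 P.T, LipschitzOnWith K (x t) P.S ∧
    ∀ X ∈ P.S, ∀ Y ∈ P.S, dist X Y ≤ K * dist (x t X) (x t Y)
  /-- the deformations of the solid preserve the orientation: `J = det F > 0` -/
  det_pos : ∀ t ∈ Icc 0 P.T, ∀ᵐ X ∂(volume.restrict P.S), 0 < (fderiv ℝ (x t) X).det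
  /-- the solid moves with the velocity `u` -/
  timeDeriv_x : HasTimeDeriv P.T P.S x (fun t X => u t (x t X))
  /-- the Lagrangian velocity of the solid lies in `H¹(0, T; L²(S)^d)` -/
  timeDeriv_U : HasTimeDeriv P.T P.S (fun t X => u t (x t X)) Ut
  /-- the momentum equation, for all test fields `v ∈ H¹₀(Ω)^d` -/
  momentum_eq : ∀ᵐ t ∂(volume.restrict (Ioc 0 P.T)),
    ∀ (v : Vec d → Vec d) (Dv : Vec d → Ten d), MemH10 P.Ω v Dv →
      ∀ DXv : Vec d → Ten d, HasWeakGrad P.S (fun X => v (x t X)) DXv →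
        P.momentum (u t) (Du t) (ut t) (p t) (x t) (Ut t) v Dv DXv = 0
  /-- the incompressibility equation, for all `q ∈ L²(Ω)` -/
  continuity_eq : ∀ᵐ t ∂(volume.restrict (Ioc 0 P.T)),
    ∀ q : Vec d → ℝ, MemLp q 2 (volume.restrict P.Ω) →
      - ∫ y in P.Ω, q y * tr (Du t y) = 0

end

/-! ### Calculus in time: primitives and energy identities. -/

section TimeCalculus

/-! Testing the momentum equation with `v = u(t)` turns it into the rate of change of the energy.
Choosing `q = div u` in the continuity equation forces `div u = 0` a.e., which removes the pressure
term and the `J⁻¹` term. It also removes the convection term, since `(u · ∇)φ · φ = u · ∇(|φ|² / 2)`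
integrates to zero against a divergence free `u`. The viscous term is the dissipation and the two
inertial terms are time derivatives of kinetic energies. For the elastic term, `∂ₜF = ∇u(x) F` gives
`F : ∇_X(u ∘ x) = F : ∂ₜF`, the derivative of `|F|² / 2`. Finally `∂ₜ det F = tr(∇u) det F = 0`
(Liouville), so the logarithmic part of `Ψ` does not change in time.

The work lies in justifying this at the given regularity.

In time, a function in `H¹(0, T; L²)` has a jointly measurable representative that is a primitive at
almost every point (`HasTimeDeriv.exists_primitive`). One-dimensional identities for absolutely
continuous functions then hold pointwise and are integrated by Fubini (`HasTimeDeriv.energy`,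
`det_primitive_eq`).

In space, the bi-Lipschitz bound dominates the image of Lebesgue measure under `x(t)`, so null sets
and `L²` functions can be composed with `x(t)`. The chain rule for `v ∘ x` follows from the smooth
case by density (`MemH10.hasWeakGrad_comp`). It makes `u` an admissible test field and yields the
evolution of `F`, column by column (`hasTimeDeriv_fderiv_apply`).

The convection term is controlled by the embedding of `H¹₀` in `L⁴` for `d = 2, 3`, which extends
its cancellation from smooth fields to `u` (`integral_convection_self_eq_zero`). -/

lemma absolutelyContinuousOnInterval_const_add_primitive {f : ℝ → ℝ} {t : ℝ}
    (hf : IntervalIntegrable f volume 0 t) (c : ℝ) :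
    AbsolutelyContinuousOnInterval (fun s => c + ∫ r in (0 : ℝ)..s, f r) 0 t := by
  have h1 : AbsolutelyContinuousOnInterval (fun _ : ℝ => c) 0 t :=
    ((LipschitzWith.const c).lipschitzOnWith (s := uIcc 0 t)).absolutelyContinuousOnInterval
  exact h1.add (hf.absolutelyContinuousOnInterval_intervalIntegral (c := 0) (by simp))

lemma ae_hasDerivAt_const_add_primitive {f : ℝ → ℝ} {t : ℝ}
    (hf : IntervalIntegrable f volume 0 t) (c : ℝ) :
    ∀ᵐ s, s ∈ uIcc 0 t → HasDerivAt (fun s => c + ∫ r in (0 : ℝ)..s, f r) (f s) s := by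
  filter_upwards [hf.ae_hasDerivAt_integral] with s hs hst
  exact (hs hst 0 (by simp)).const_add c

/-- The primitive is absolutely continuous with a.e. derivative `f`, so it may be integrated by
parts against itself. -/
lemma integral_mul_primitive {f : ℝ → ℝ} {t : ℝ}
    (hf : IntervalIntegrable f volume 0 t) (c : ℝ) :
    ∫ s in (0 : ℝ)..t, f s * (c + ∫ r in (0 : ℝ)..s, f r)
      = ((c + ∫ r in (0 : ℝ)..t, f r) ^ 2 - c ^ 2) / 2 := by
  have hac := absolutelyContinuousOnInterval_const_add_primitive hf c
  have h := hac.integral_deriv_mul_eq_sub hac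
  have h2 : ∫ s in (0 : ℝ)..t, 2 * (f s * (c + ∫ r in (0 : ℝ)..s, f r)) =
      (c + ∫ r in (0 : ℝ)..t, f r) ^ 2 - c ^ 2 := by
    simp only [intervalIntegral.integral_same, add_zero] at h
    rw [sq, sq, ← h]
    apply intervalIntegral.integral_congr_ae
    filter_upwards [ae_hasDerivAt_const_add_primitive hf c] with s hs hst
    rw [(hs (uIoc_subset_uIcc hst)).deriv]
    ring
  rw [intervalIntegral.integral_const_mul] at h2
  linarith

lemma intervalIntegral_apply {d : ℕ} {g : ℝ → Vec d} {t : ℝ}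
    (hg : IntervalIntegrable g volume 0 t) (i : Fin d) :
    (∫ s in (0 : ℝ)..t, g s) i = ∫ s in (0 : ℝ)..t, g s i :=
  ((EuclideanSpace.proj (𝕜 := ℝ) i).intervalIntegral_comp_comm hg).symm

lemma IntervalIntegrable.euclidean_apply {d : ℕ} {g : ℝ → Vec d} {a b : ℝ}
    (hg : IntervalIntegrable g volume a b) (i : Fin d) :
    IntervalIntegrable (fun s => g s i) volume a b :=
  ⟨(EuclideanSpace.proj (𝕜 := ℝ) i).integrable_comp hg.1,
    (EuclideanSpace.proj (𝕜 := ℝ) i).integrable_comp hg.2⟩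

/-- The chain rule for `‖a + ∫ g‖²`. -/
lemma integral_inner_primitive {d : ℕ} {g : ℝ → Vec d} {t : ℝ}
    (hg : IntervalIntegrable g volume 0 t) (a : Vec d) :
    ∫ s in (0 : ℝ)..t, inner ℝ (g s) (a + ∫ r in (0 : ℝ)..s, g r)
      = (‖a + ∫ r in (0 : ℝ)..t, g r‖ ^ 2 - ‖a‖ ^ 2) / 2 := by
  have hgs : ∀ s ∈ uIcc 0 t, IntervalIntegrable g volume 0 s := fun s hs =>
    hg.mono_set (uIcc_subset_uIcc_left hs)
  have h1 : ∫ s in (0 : ℝ)..t, inner ℝ (g s) (a + ∫ r in (0 : ℝ)..s, g r) =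
      ∫ s in (0 : ℝ)..t, ∑ i, g s i * (a i + ∫ r in (0 : ℝ)..s, g r i) := by
    apply intervalIntegral.integral_congr
    intro s hs
    simp only [PiLp.inner_apply, PiLp.add_apply, intervalIntegral_apply (hgs s hs),
      RCLike.inner_apply, conj_trivial, mul_comm]
  rw [h1, intervalIntegral.integral_finsetSum]
  · simp only [integral_mul_primitive (hg.euclidean_apply _), EuclideanSpace.real_norm_sq_eq,
      PiLp.add_apply, intervalIntegral_apply hg, ← Finset.sum_sub_distrib, Finset.sum_div]
  · intro i _
    exact (hg.euclidean_apply i).mul_continuousOn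
      (absolutelyContinuousOnInterval_const_add_primitive (hg.euclidean_apply i) _).continuousOn

lemma integrable_inner_of_memLp_two {α E : Type*} [MeasurableSpace α] {μ : Measure α}
    [NormedAddCommGroup E] [InnerProductSpace ℝ E] {f g : α → E}
    (hf : MemLp f 2 μ) (hg : MemLp g 2 μ) : Integrable (fun y => inner ℝ (f y) (g y)) μ :=
  (hf.norm.integrable_mul hg.norm).mono' (hf.1.inner hg.1)
    (Filter.Eventually.of_forall fun _ => norm_inner_le_norm _ _)

/-- Cauchy–Schwarz against the constant `1`, obtained from the nonnegativity of the variance about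
the mean `m`. -/
lemma sq_integral_le_mul_integral_sq {α : Type*} [MeasurableSpace α] {μ : Measure α}
    [IsFiniteMeasure μ] {h : α → ℝ} (hh : MemLp h 2 μ) :
    (∫ r, h r ∂μ) ^ 2 ≤ μ.real univ * ∫ r, h r ^ 2 ∂μ := by
  have hi : Integrable h μ := hh.integrable (by norm_num)
  have hs : Integrable (fun r => h r ^ 2) μ := hh.integrable_sq
  rcases (measureReal_nonneg (μ := μ) (s := univ)).eq_or_lt with h0 | h0
  · have : μ = 0 := by
      rw [← Measure.measure_univ_eq_zero]
      exact (measureReal_eq_zero_iff).1 h0.symm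
    simp [this]
  · set M := μ.real univ
    set m := (∫ r, h r ∂μ) / M
    have h1 : 0 ≤ ∫ r, (h r - m) ^ 2 ∂μ := integral_nonneg fun r => sq_nonneg _
    have h2 : ∫ r, (h r - m) ^ 2 ∂μ = ∫ r, h r ^ 2 ∂μ - 2 * m * (∫ r, h r ∂μ) + M * m ^ 2 := by
      have : ∀ r, (h r - m) ^ 2 = h r ^ 2 - 2 * m * h r + m ^ 2 := fun r => by ring
      simp only [this]
      have hd : Integrable (fun r => h r ^ 2 - 2 * m * h r) μ := hs.sub (hi.const_mul _)
      rw [integral_add hd (integrable_const _), integral_sub hs (hi.const_mul _), integral_const_mul, integral_const]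
      simp [M]
    have h3 : (∫ r, h r ∂μ) = m * M := by simp only [m]; field_simp
    rw [h2, h3] at h1
    rw [h3]
    nlinarith

/-- A jointly measurable representative of `f ∈ H¹(0, T; L²(A)^d)` which is a primitive in time at
almost every point. -/
lemma HasTimeDeriv.exists_primitive {d : ℕ} {T : ℝ} {A : Set (Vec d)} {f f' : ℝ → Vec d → Vec d}
    (h : HasTimeDeriv T A f f') (hT : 0 ≤ T) :
    ∃ w : ℝ → Vec d → Vec d, StronglyMeasurable (Function.uncurry w) ∧
      (∀ s ∈ Icc 0 T, MemLp (w s) 2 (volume.restrict A)) ∧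
      MemLp (Function.uncurry w) 2 ((volume.restrict (Ioc 0 T)).prod (volume.restrict A)) ∧
      (∀ s ∈ Icc 0 T, ∀ᵐ y ∂(volume.restrict A), f s y = w s y) ∧
      ∀ᵐ y ∂(volume.restrict A), IntervalIntegrable (fun s => f' s y) volume 0 T ∧
        ∀ s ∈ Icc 0 T, w s y = w 0 y + ∫ r in (0 : ℝ)..s, f' r y := by
  set μ := (volume : Measure ℝ).restrict (Ioc 0 T) with hμ
  set ν := (volume : Measure (Vec d)).restrict A
  have hmem := h.memLp_deriv
  set g := hmem.1.mk (Function.uncurry f')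
  have hg : StronglyMeasurable g := hmem.1.stronglyMeasurable_mk
  have hfg : Function.uncurry f' =ᵐ[μ.prod ν] g := hmem.1.ae_eq_mk
  have hgL : MemLp g 2 (μ.prod ν) := (memLp_congr_ae hfg).1 hmem
  set a := h.memLp_init.1.mk (f 0)
  have ha : StronglyMeasurable a := h.memLp_init.1.stronglyMeasurable_mk
  have hfa : f 0 =ᵐ[ν] a := h.memLp_init.1.ae_eq_mk
  have haL : MemLp a 2 ν := (memLp_congr_ae hfa).1 h.memLp_init
  have hsw : ∀ᵐ y ∂ν, ∀ᵐ r ∂μ, f' r y = g (r, y) := by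
    have : ∀ᵐ z ∂(ν.prod μ), f' z.2 z.1 = g (z.2, z.1) :=
      (Measure.measurePreserving_swap (μ := ν) (ν := μ)).quasiMeasurePreserving.ae hfg
    exact Measure.ae_ae_of_ae_prod this
  have hsq : Integrable (fun z => ‖g z‖ ^ 2) (μ.prod ν) := hgL.integrable_norm_pow (by norm_num)
  have hy2 : ∀ᵐ y ∂ν, MemLp (fun r => g (r, y)) 2 μ := by
    filter_upwards [hsq.prod_left_ae] with y hy
    exact (memLp_two_iff_integrable_sq_norm
      (hg.comp_measurable (by fun_prop)).aestronglyMeasurable).2 hy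
  -- A majorant of `‖w s y‖` that does not depend on `s`; it places each `w s`, and `w` on
  -- space-time, in `L²`.
  set b : Vec d → ℝ := fun y => ‖a y‖ + ∫ r, ‖g (r, y)‖ ∂μ
  have hb : MemLp b 2 ν := by
    refine haL.norm.add ?_
    have hm : StronglyMeasurable (fun y => ∫ r, ‖g (r, y)‖ ∂μ) :=
      StronglyMeasurable.integral_prod_left' (f := fun z : ℝ × Vec d => ‖g z‖) hg.norm
    refine (memLp_two_iff_integrable_sq hm.aestronglyMeasurable).2 ?_
    refine (hsq.integral_prod_right.const_mul (μ.real univ)).mono'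
      (hm.pow 2).aestronglyMeasurable ?_
    filter_upwards [hy2] with y hy
    rw [Real.norm_of_nonneg (sq_nonneg _)]
    exact sq_integral_le_mul_integral_sq hy.norm
  -- Integrating a cut-off over all of `(0, T]`, rather than `g` over `(0, s]`, reduces joint
  -- measurability in `(s, y)` to that of a parametric integral.
  set w : ℝ → Vec d → Vec d := fun s y => a y + ∫ r, (Iic s).indicator (fun r => g (r, y)) r ∂μ
  have hwm : StronglyMeasurable (Function.uncurry w) := by
    have h1 : StronglyMeasurable (fun z : (ℝ × Vec d) × ℝ =>
        (Iic z.1.1).indicator (fun r => g (r, z.1.2)) z.2) := by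
      have : (fun z : (ℝ × Vec d) × ℝ => (Iic z.1.1).indicator (fun r => g (r, z.1.2)) z.2) =
          {z : (ℝ × Vec d) × ℝ | z.2 ≤ z.1.1}.indicator (fun z => g (z.2, z.1.2)) := by
        ext1 z
        simp [indicator]
      rw [this]
      exact (hg.comp_measurable (by fun_prop)).indicator
        (measurableSet_le (by fun_prop) (by fun_prop))
    exact (ha.comp_measurable measurable_snd).add h1.integral_prod_right'
  have hwb : ∀ᵐ y ∂ν, ∀ s, ‖w s y‖ ≤ ‖b y‖ := by
    filter_upwards [hy2] with y hy s
    have hi : Integrable (fun r => ‖g (r, y)‖) μ := (hy.integrable (by norm_num)).norm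
    refine (norm_add_le _ _).trans (le_trans ?_ (le_abs_self _))
    refine add_le_add le_rfl ((norm_integral_le_integral_norm _).trans ?_)
    refine integral_mono_of_nonneg (Filter.Eventually.of_forall fun _ => norm_nonneg _) hi ?_
    exact Filter.Eventually.of_forall fun r => norm_indicator_le_norm_self _ _
  have hwint : ∀ᵐ y ∂ν, IntervalIntegrable (fun s => f' s y) volume 0 T ∧
        ∀ s ∈ Icc 0 T, w s y = a y + ∫ r in (0 : ℝ)..s, f' r y := by
    filter_upwards [hy2, hsw] with y hy hfy
    refine ⟨?_, fun s hs => ?_⟩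
    · rw [intervalIntegrable_iff_integrableOn_Ioc_of_le hT]
      exact (hy.integrable (by norm_num)).congr (hfy.mono fun _ h => h.symm)
    · simp only [w]
      rw [integral_indicator measurableSet_Iic, hμ, Measure.restrict_restrict measurableSet_Iic,
        intervalIntegral.integral_of_le hs.1,
        show Iic s ∩ Ioc 0 T = Ioc 0 s by
          ext r; simp only [mem_inter_iff, mem_Iic, mem_Ioc]
          exact ⟨fun h => ⟨h.2.1, h.1⟩, fun h => ⟨h.2, h.1, h.2.trans hs.2⟩⟩]
      congr 1
      refine integral_congr_ae ?_
      filter_upwards [ae_restrict_of_ae_restrict_of_subset (Ioc_subset_Ioc_right hs.2) hfy]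
        with r hr using hr.symm
  refine ⟨w, hwm, fun s _ => ?_, ?_, fun s hs => ?_, ?_⟩
  · exact hb.of_le (hwm.comp_measurable measurable_prodMk_left).aestronglyMeasurable
      (hwb.mono fun y hy => hy s)
  · refine (hb.comp_snd μ).of_le hwm.aestronglyMeasurable ?_
    exact (Measure.quasiMeasurePreserving_snd.ae hwb).mono fun z hz => hz z.1
  · filter_upwards [h.eq_add_integral s hs, hwint, hfa] with y h1 h2 h3
    rw [h1, h2.2 s hs, h3]
  · filter_upwards [hwint] with y hy
    refine ⟨hy.1, fun s hs => ?_⟩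
    rw [hy.2 s hs, hy.2 0 ⟨le_rfl, hT⟩]
    simp

/-- The energy identity for `f ∈ H¹(0, T; L²(A)^d)`. -/
lemma HasTimeDeriv.energy {d : ℕ} {T : ℝ} {A : Set (Vec d)} {f f' : ℝ → Vec d → Vec d}
    (h : HasTimeDeriv T A f f') {t : ℝ} (ht : t ∈ Icc 0 T) :
    MemLp (f t) 2 (volume.restrict A) ∧
    IntervalIntegrable (fun s => ∫ y in A, inner ℝ (f' s y) (f s y)) volume 0 t ∧
    ∫ s in (0 : ℝ)..t, ∫ y in A, inner ℝ (f' s y) (f s y) =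
      ((∫ y in A, ‖f t y‖ ^ 2) - ∫ y in A, ‖f 0 y‖ ^ 2) / 2 := by
  have hT : 0 ≤ T := ht.1.trans ht.2
  obtain ⟨w, -, hws, hwL, hfw, hwy⟩ := h.exists_primitive hT
  have hsub : Ioc 0 t ⊆ Ioc 0 T := Ioc_subset_Ioc_right ht.2
  have hint : Integrable (fun z : ℝ × Vec d => inner ℝ (f' z.1 z.2) (w z.1 z.2))
      ((volume.restrict (Ioc 0 t)).prod (volume.restrict A)) := by
    refine (integrable_inner_of_memLp_two h.memLp_deriv hwL).mono_measure ?_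
    exact Measure.prod_mono (Measure.restrict_mono hsub le_rfl) le_rfl
  have hcongr : ∀ s ∈ Icc 0 T, ∫ y in A, inner ℝ (f' s y) (f s y) =
      ∫ y in A, inner ℝ (f' s y) (w s y) := fun s hs =>
    integral_congr_ae ((hfw s hs).mono fun y hy => by simp only [hy])
  have hinv : ∀ s ∈ Icc 0 T, ∫ y in A, ‖f s y‖ ^ 2 = ∫ y in A, ‖w s y‖ ^ 2 := fun s hs =>
    integral_congr_ae ((hfw s hs).mono fun y hy => by simp only [hy])
  refine ⟨(memLp_congr_ae (hfw t ht)).2 (hws t ht), ?_, ?_⟩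
  · rw [intervalIntegrable_iff_integrableOn_Ioc_of_le ht.1]
    refine (hint.integral_prod_left).congr ?_
    filter_upwards [ae_restrict_mem measurableSet_Ioc] with s hs
    exact (hcongr s (Ioc_subset_Icc_self (hsub hs))).symm
  · rw [hinv t ht, hinv 0 ⟨le_rfl, hT⟩,
      ← integral_sub ((hws t ht).integrable_norm_pow (by norm_num))
        ((hws 0 ⟨le_rfl, hT⟩).integrable_norm_pow (by norm_num)), ← integral_div]
    rw [intervalIntegral.integral_of_le ht.1]
    have h1 : ∫ s in Ioc 0 t, ∫ y in A, inner ℝ (f' s y) (f s y) =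
        ∫ s in Ioc 0 t, ∫ y in A, inner ℝ (f' s y) (w s y) :=
      setIntegral_congr_fun measurableSet_Ioc
        fun s hs => hcongr s (Ioc_subset_Icc_self (hsub hs))
    rw [h1, integral_integral_swap hint]
    refine integral_congr_ae ?_
    filter_upwards [hwy] with y hy
    have hti : IntervalIntegrable (fun s => f' s y) volume 0 t :=
      hy.1.mono_set (by rw [uIcc_of_le ht.1, uIcc_of_le hT]; exact Icc_subset_Icc_right ht.2)
    rw [hy.2 t ht, ← integral_inner_primitive hti, intervalIntegral.integral_of_le ht.1]
    refine setIntegral_congr_fun measurableSet_Ioc fun s hs => ?_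
    rw [hy.2 s (Ioc_subset_Icc_self (hsub hs))]

end TimeCalculus

/-! ### Transfer of measures and `L²` norms through bi-Lipschitz maps. -/

section BiLipschitz

open scoped ENNReal

/-- A map which is expanding up to the factor `K` on `S` pulls sets back to sets of controlled
volume. -/
lemma volume_inter_preimage_le {d : ℕ} {S : Set (Vec d)} {x : Vec d → Vec d} {K : ℝ≥0}
    (hx : ∀ X ∈ S, ∀ Y ∈ S, dist X Y ≤ K * dist (x X) (x Y)) (B : Set (Vec d)) :
    volume (S ∩ x ⁻¹' B) ≤ (K : ℝ≥0∞) ^ d * volume B := by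
  have hinj : InjOn x S := fun X hX Y hY hXY => by
    have := hx X hX Y hY
    rw [hXY, dist_self, mul_zero] at this
    exact dist_le_zero.1 this
  -- The inverse of `x` is `K`-Lipschitz on the image, so it enlarges `d`-dimensional Hausdorff
  -- measure by at most `K ^ d`. By uniqueness of Haar measure, `volume` is a multiple of that
  -- measure.
  set g := Function.invFunOn x S
  have hg : ∀ X ∈ S, g (x X) = X := fun X hX => hinj.leftInvOn_invFunOn hX
  have hlip : LipschitzOnWith K g (x '' (S ∩ x ⁻¹' B)) := by
    refine LipschitzOnWith.of_dist_le_mul ?_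
    rintro _ ⟨X, hX, rfl⟩ _ ⟨Y, hY, rfl⟩
    rw [hg X hX.1, hg Y hY.1]
    exact hx X hX.1 Y hY.1
  have himg : g '' (x '' (S ∩ x ⁻¹' B)) = S ∩ x ⁻¹' B := by
    rw [image_image]
    ext X
    constructor
    · rintro ⟨Y, hY, rfl⟩
      change g (x Y) ∈ _
      rwa [hg Y hY.1]
    · exact fun hX => ⟨X, hX, hg X hX.1⟩
  have hH := hlip.hausdorffMeasure_image_le (d := d) (Nat.cast_nonneg d)
  rw [himg, ENNReal.rpow_natCast] at hH
  have hvol := Measure.isAddLeftInvariant_eq_smul (volume : Measure (Vec d))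
    (Measure.hausdorffMeasure (d : ℝ))
  rw [hvol]
  simp only [Measure.smul_apply, ENNReal.smul_def, smul_eq_mul]
  rw [mul_left_comm]
  gcongr
  refine hH.trans ?_
  gcongr
  rintro _ ⟨X, hX, rfl⟩
  exact hX.2

/-- The form in which the lower Lipschitz bound is mostly used: domination of the image measure
carries null sets, measurability and `L²` bounds from `Ω` to `S`. -/
lemma map_restrict_le_of_biLipschitz {d : ℕ} {S Ω : Set (Vec d)} {x : Vec d → Vec d} {K : ℝ≥0}
    (hS : MeasurableSet S) (hxc : ContinuousOn x S) (hxm : MapsTo x S Ω)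
    (hx : ∀ X ∈ S, ∀ Y ∈ S, dist X Y ≤ K * dist (x X) (x Y)) :
    (volume.restrict S).map x ≤ (K : ℝ≥0∞) ^ d • volume.restrict Ω := by
  refine Measure.le_iff.2 fun B hB => ?_
  rw [Measure.map_apply_of_aemeasurable (hxc.aemeasurable hS) hB, Measure.smul_apply,
    Measure.restrict_apply hB, smul_eq_mul, Measure.restrict_apply' hS]
  refine le_trans ?_ (volume_inter_preimage_le hx (B ∩ Ω))
  exact measure_mono fun X hX => ⟨hX.2, hX.1, hxm hX.2⟩

lemma map_prod_restrict_le {α β : Type*} [MeasurableSpace α] [MeasurableSpace β]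
    {μ : Measure α} {ν ν' : Measure β} [SFinite μ] [SFinite ν] [SFinite ν'] {y : α × β → β}
    (hy : Measurable y) {c : ℝ≥0∞} (h : ∀ᵐ s ∂μ, ν.map (fun X => y (s, X)) ≤ c • ν') :
    (μ.prod ν).map (fun z => (z.1, y z)) ≤ c • μ.prod ν' := by
  have hm : Measurable (fun z : α × β => (z.1, y z)) := by fun_prop
  refine Measure.le_iff.2 fun B hB => ?_
  rw [Measure.map_apply hm hB, Measure.prod_apply (hm hB), Measure.smul_apply,
    Measure.prod_apply hB, smul_eq_mul, ← lintegral_const_mul _ (measurable_measure_prodMk_left hB)]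
  refine lintegral_mono_ae ?_
  filter_upwards [h] with s hs
  have := hs (Prod.mk s ⁻¹' B)
  rwa [Measure.map_apply (by fun_prop) (measurable_prodMk_left hB), Measure.smul_apply,
    smul_eq_mul] at this

lemma MeasureTheory.MemLp.comp_of_map_le {α β E : Type*} [MeasurableSpace α] [MeasurableSpace β]
    [NormedAddCommGroup E] {μ : Measure α} {ν : Measure β} {x : α → β} {c p : ℝ≥0∞} {f : β → E}
    (hf : MemLp f p ν) (hx : AEMeasurable x μ) (hc : c ≠ ⊤) (h : μ.map x ≤ c • ν) :
    MemLp (fun X => f (x X)) p μ :=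
  MemLp.comp_of_map ((hf.smul_measure hc).mono_measure h) hx

lemma ae_of_map_le {α β : Type*} [MeasurableSpace α] [MeasurableSpace β]
    {μ : Measure α} {ν : Measure β} {x : α → β} {c : ℝ≥0∞}
    (hx : AEMeasurable x μ) (h : μ.map x ≤ c • ν) {P : β → Prop} (hP : ∀ᵐ y ∂ν, P y) :
    ∀ᵐ X ∂μ, P (x X) :=
  ae_of_ae_map hx (((Measure.absolutelyContinuous_of_le h).trans
    Measure.smul_absolutelyContinuous).ae_le hP)

lemma eLpNorm_two_comp_le {α β E : Type*} [MeasurableSpace α] [MeasurableSpace β]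
    [NormedAddCommGroup E] {μ : Measure α} {ν : Measure β} {x : α → β} {c : ℝ≥0∞} {f : β → E}
    (hf : AEStronglyMeasurable f ν) (hx : AEMeasurable x μ) (h : μ.map x ≤ c • ν) :
    eLpNorm (fun X => f (x X)) 2 μ ≤ c ^ (1 / 2 : ℝ) * eLpNorm f 2 ν := by
  have hac : μ.map x ≪ ν :=
    (Measure.absolutelyContinuous_of_le h).trans Measure.smul_absolutelyContinuous
  have h1 : eLpNorm (fun X => f (x X)) 2 μ = eLpNorm f 2 (μ.map x) :=
    (eLpNorm_map_measure (hf.mono_ac hac) hx).symm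
  rw [h1]
  refine (eLpNorm_mono_measure f h).trans ?_
  rw [eLpNorm_smul_measure_of_ne_top (by norm_num)]
  simp

end BiLipschitz

/-! ### Weak gradients of Lipschitz maps and of compositions. -/

section WeakGradient

open Filter Topology

lemma isFiniteMeasure_restrict_of_isBounded {d : ℕ} {S : Set (Vec d)}
    (hS : Bornology.IsBounded S) : IsFiniteMeasure (volume.restrict S) :=
  ⟨by simpa using hS.measure_lt_top⟩

lemma LipschitzOnWith.ae_differentiableAt_of_isOpen {d : ℕ} {S : Set (Vec d)} {g : Vec d → Vec d}
    {K : ℝ≥0} (hS : IsOpen S) (hg : LipschitzOnWith K g S) :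
    ∀ᵐ X ∂(volume.restrict S), DifferentiableAt ℝ g X := by
  filter_upwards [hg.ae_differentiableWithinAt (μ := volume) hS.measurableSet,
    ae_restrict_mem hS.measurableSet] with X hX hXS
  exact hX.differentiableAt (hS.mem_nhds hXS)

lemma memLp_fderiv_of_lipschitzOn {d : ℕ} {S : Set (Vec d)} {g : Vec d → Vec d} {K : ℝ≥0}
    (hS : IsOpen S) (hg : LipschitzOnWith K g S) :
    MemLp (fderiv ℝ g) ⊤ (volume.restrict S) := by
  refine memLp_top_of_bound (measurable_fderiv ℝ g).aestronglyMeasurable K ?_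
  filter_upwards [ae_restrict_mem hS.measurableSet] with X hX
  exact norm_fderiv_le_of_lipschitzOn ℝ (hS.mem_nhds hX) hg

/-- The classical derivative of a Lipschitz map is its weak gradient. -/
lemma hasWeakGrad_fderiv_of_lipschitzOn {d : ℕ} {S : Set (Vec d)} {g : Vec d → Vec d} {K : ℝ≥0}
    (hS : IsOpen S) (hSb : Bornology.IsBounded S) (hg : LipschitzOnWith K g S) :
    HasWeakGrad S g (fderiv ℝ g) := by
  have := isFiniteMeasure_restrict_of_isBounded hSb
  refine ⟨hg.continuousOn.locallyIntegrableOn hS.measurableSet,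
    IntegrableOn.locallyIntegrableOn
      ((memLp_fderiv_of_lipschitzOn hS hg).integrable le_top : Integrable _ _), ?_⟩
  intro φ hφ hφc hφS e
  -- A global Lipschitz extension moves the integration by parts to the whole space; `φ` and its
  -- derivative vanish off `S`, so neither integral changes.
  obtain ⟨G, hG, hGg⟩ := hg.extend_finite_dimension
  have hfd : ∀ y ∈ S, fderiv ℝ g y = fderiv ℝ G y := fun y hy =>
    Filter.EventuallyEq.fderiv_eq (by filter_upwards [hS.mem_nhds hy] with z hz using hGg hz)
  have hφ0 : ∀ y, y ∉ S → φ y = 0 := fun y hy => image_eq_zero_of_notMem_tsupport fun h => hy (hφS h)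
  have hDφ0 : ∀ y, y ∉ S → fderiv ℝ φ y = 0 := fun y hy =>
    image_eq_zero_of_notMem_tsupport fun h => hy (hφS (tsupport_fderiv_subset ℝ h))
  have hl : ∫ y in S, (fderiv ℝ φ y e) • g y = ∫ y, (fderiv ℝ φ y e) • G y := by
    rw [← setIntegral_eq_integral_of_forall_compl_eq_zero (s := S) (f := fun y => _ • G y)]
    · exact setIntegral_congr_fun hS.measurableSet fun y hy => by simp only [hGg hy]
    · intro y hy; simp [hDφ0 y hy]
  have hr : ∫ y in S, φ y • (fderiv ℝ g y e) = ∫ y, φ y • (fderiv ℝ G y e) := by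
    rw [← setIntegral_eq_integral_of_forall_compl_eq_zero (s := S) (f := fun y => _ • fderiv ℝ G y e)]
    · exact setIntegral_congr_fun hS.measurableSet fun y hy => by simp only [hfd y hy]
    · intro y hy; simp [hφ0 y hy]
  rw [hl, hr]
  have hφ1 : ContDiff ℝ 1 φ := hφ.of_le (by exact_mod_cast le_top)
  have hDc : Continuous fun y => fderiv ℝ φ y e :=
    (hφ1.continuous_fderiv (by norm_num)).clm_apply continuous_const
  have hDcs : HasCompactSupport fun y => fderiv ℝ φ y e := hφc.fderiv_apply ℝ e
  have hil : Integrable fun y => (fderiv ℝ φ y e) • G y :=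
    (hDc.smul hG.continuous).integrable_of_hasCompactSupport hDcs.smul_right
  have hmG : Measurable fun y => fderiv ℝ G y e := measurable_fderiv_apply_const ℝ G e
  have hir : Integrable fun y => φ y • (fderiv ℝ G y e) := by
    refine ((hφ.continuous.integrable_of_hasCompactSupport hφc).norm.mul_const
      (lipschitzExtensionConstant (Vec d) * K * ‖e‖)).mono'
      (hφ.continuous.aestronglyMeasurable.smul hmG.aestronglyMeasurable) ?_
    refine Eventually.of_forall fun y => ?_
    rw [norm_smul]
    gcongr
    refine (ContinuousLinearMap.le_opNorm _ _).trans ?_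
    gcongr
    exact norm_fderiv_le_of_lipschitz ℝ hG
  obtain ⟨C, hC⟩ := hφ1.lipschitzWith_of_hasCompactSupport hφc (by norm_num)
  ext i
  rw [PiLp.neg_apply, eval_integral_piLp, eval_integral_piLp]
  rotate_left
  · exact fun i => (EuclideanSpace.proj (𝕜 := ℝ) i).integrable_comp hir
  · exact fun i => (EuclideanSpace.proj (𝕜 := ℝ) i).integrable_comp hil
  have hGi : LipschitzWith (lipschitzExtensionConstant (Vec d) * K) fun y => G y i := by
    refine LipschitzWith.of_dist_le_mul fun y z => (?_ : _ ≤ dist (G y) (G z)).trans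
      (hG.dist_le_mul y z)
    rw [EuclideanSpace.dist_eq, Real.dist_eq]
    refine Real.le_sqrt_of_sq_le ?_
    rw [sq_abs]
    refine le_trans (le_of_eq ?_) (Finset.single_le_sum (f := fun i => dist (G y i) (G z i) ^ 2)
      (fun _ _ => sq_nonneg _) (Finset.mem_univ i))
    rw [Real.dist_eq, sq_abs]
  -- Integration by parts for line derivatives; the minus sign sits in the direction `-e`.
  have key := LipschitzWith.integral_lineDeriv_mul_eq (μ := volume) hGi hC hφc e
  have e1 : ∫ y, φ y • (fderiv ℝ G y e) i = ∫ y, lineDeriv ℝ (fun y => G y i) y e * φ y := by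
    refine integral_congr_ae ?_
    filter_upwards [hG.ae_differentiableAt (μ := volume)] with y hy
    have := ((EuclideanSpace.proj (𝕜 := ℝ) i : Vec d →L[ℝ] ℝ).hasFDerivAt.comp y hy.hasFDerivAt)
    have h2 := this.hasLineDerivAt e
    rw [show (fun y => G y i) = (EuclideanSpace.proj (𝕜 := ℝ) i : Vec d →L[ℝ] ℝ) ∘ G from rfl,
      h2.lineDeriv]
    simp [mul_comm]
  have e2 : ∫ y, ((fderiv ℝ φ y e) • G y) i = - ∫ y, lineDeriv ℝ φ y (-e) * G y i := by
    rw [← integral_neg]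
    refine integral_congr_ae (Eventually.of_forall fun y => ?_)
    simp [((hφ1.differentiable (by norm_num)) y).lineDeriv_eq_fderiv]
  have e3 : ∫ y, (φ y • (fderiv ℝ G y e)) i = ∫ y, φ y • (fderiv ℝ G y e) i := rfl
  rw [e2, e3, e1, key]

lemma ENNReal.tendsto_zero_of_le {a b : ℕ → ENNReal} (hb : Tendsto b atTop (𝓝 0))
    (h : ∀ n, a n ≤ b n) : Tendsto a atTop (𝓝 0) :=
  tendsto_of_tendsto_of_tendsto_of_le_of_le tendsto_const_nhds hb (fun _ => zero_le) h

lemma tendsto_integral_smul_of_eLpNorm_two {α E : Type*} [MeasurableSpace α]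
    [NormedAddCommGroup E] [NormedSpace ℝ E] {μ : Measure α} {c : α → ℝ} {f : ℕ → α → E}
    {g : α → E} (hc : MemLp c 2 μ) (hf : ∀ n, MemLp (f n) 2 μ) (hg : MemLp g 2 μ)
    (h : Tendsto (fun n => eLpNorm (f n - g) 2 μ) atTop (𝓝 0)) :
    Tendsto (fun n => ∫ y, c y • f n y ∂μ) atTop (𝓝 (∫ y, c y • g y ∂μ)) := by
  refine tendsto_integral_of_L1' _ (hc.1.smul hg.1)
    (Eventually.of_forall fun n => memLp_one_iff_integrable.1 ((hf n).smul hc)) ?_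
  have h0 : Tendsto (fun n => eLpNorm c 2 μ * eLpNorm (f n - g) 2 μ) atTop (𝓝 0) := by
    simpa using ENNReal.Tendsto.const_mul h (Or.inr hc.2.ne)
  refine ENNReal.tendsto_zero_of_le h0 fun n => ?_
  have : ((fun y => c y • f n y) - c • g) = c • (f n - g) := by
    ext1 y; exact (smul_sub _ _ _).symm
  rw [this]
  exact eLpNorm_smul_le_mul_eLpNorm (p := 2) (q := 2) (r := 1) ((hf n).1.sub hg.1) hc.1

/-- A sequence of smooth, compactly supported fields converging to `v` in `H¹`. -/
lemma MemH10.exists_seq {d : ℕ} {Ω : Set (Vec d)} {v : Vec d → Vec d} {Dv : Vec d → Ten d}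
    (hv : MemH10 Ω v Dv) : ∃ φ : ℕ → Vec d → Vec d,
      (∀ n, ContDiff ℝ ∞ (φ n) ∧ HasCompactSupport (φ n) ∧ tsupport (φ n) ⊆ Ω) ∧
      (∀ n, eLpNorm (φ n - v) 2 (volume.restrict Ω) ≤ ((1 / 2 : ℝ≥0) ^ n : ℝ≥0)) ∧
      ∀ n, eLpNorm (fderiv ℝ (φ n) - Dv) 2 (volume.restrict Ω) ≤ ((1 / 2 : ℝ≥0) ^ n : ℝ≥0) := by
  choose φ h1 h2 h3 h4 h5 using fun n : ℕ => hv.2 ((1 / 2 : ℝ≥0) ^ n) (by positivity)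
  refine ⟨φ, fun n => ⟨h1 n, h2 n, h3 n⟩, fun n => ?_, fun n => ?_⟩
  · rw [eLpNorm_sub_comm]; exact h4 n
  · rw [eLpNorm_sub_comm]; exact h5 n

lemma tendsto_zero_of_le_two_pow {a : ℕ → ENNReal}
    (h : ∀ n, a n ≤ ((1 / 2 : ℝ≥0) ^ n : ℝ≥0)) : Tendsto a atTop (𝓝 0) := by
  refine ENNReal.tendsto_zero_of_le ?_ h
  rw [← ENNReal.coe_zero, ENNReal.tendsto_coe]
  exact tendsto_pow_atTop_nhds_zero_of_lt_one (zero_le) (by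
    rw [← NNReal.coe_lt_coe]; norm_num)

lemma aestronglyMeasurable_ten_apply {α : Type*} [MeasurableSpace α] {μ : Measure α} {d : ℕ}
    {A : α → Ten d} {w : α → Vec d} (hA : AEStronglyMeasurable A μ)
    (hw : AEStronglyMeasurable w μ) : AEStronglyMeasurable (fun X => A X (w X)) μ :=
  (isBoundedBilinearMap_apply (𝕜 := ℝ) (E := Vec d)
    (F := Vec d)).continuous.comp_aestronglyMeasurable (hA.prodMk hw)

lemma aestronglyMeasurable_ten_comp {α : Type*} [MeasurableSpace α] {μ : Measure α} {d : ℕ}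
    {A B : α → Ten d} (hA : AEStronglyMeasurable A μ)
    (hB : AEStronglyMeasurable B μ) : AEStronglyMeasurable (fun X => A X ∘L B X) μ :=
  (isBoundedBilinearMap_comp (𝕜 := ℝ) (E := Vec d) (F := Vec d)
    (G := Vec d)).continuous.comp_aestronglyMeasurable (hA.prodMk hB)

/-- The chain rule for the composition of an `H¹₀` field with a bi-Lipschitz map. -/
lemma MemH10.hasWeakGrad_comp {d : ℕ} {Ω S : Set (Vec d)} {v : Vec d → Vec d} {Dv : Vec d → Ten d}
    (hv : MemH10 Ω v Dv) (hS : IsOpen S) (hSb : Bornology.IsBounded S) {x : Vec d → Vec d}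
    {K : ℝ≥0} (hx : LipschitzOnWith K x S) {c : ENNReal} (hc : c ≠ ⊤)
    (hle : (volume.restrict S).map x ≤ c • volume.restrict Ω) :
    HasWeakGrad S (fun X => v (x X)) (fun X => Dv (x X) ∘L fderiv ℝ x X) := by
  have := isFiniteMeasure_restrict_of_isBounded hSb
  obtain ⟨φ, hφ, hφv, hφD⟩ := hv.exists_seq
  have hxm : AEMeasurable x (volume.restrict S) := hx.continuousOn.aemeasurable hS.measurableSet
  have hF := memLp_fderiv_of_lipschitzOn hS hx
  have hvx : MemLp (fun X => v (x X)) 2 (volume.restrict S) := hv.1.1.comp_of_map_le hxm hc hle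
  have hDx : MemLp (fun X => Dv (x X)) 2 (volume.restrict S) := hv.1.2.1.comp_of_map_le hxm hc hle
  have hFK : ∀ᵐ X ∂(volume.restrict S), ‖fderiv ℝ x X‖ ≤ K := by
    filter_upwards [ae_restrict_mem hS.measurableSet] with X hX
    exact norm_fderiv_le_of_lipschitzOn ℝ (hS.mem_nhds hX) hx
  have hFm : AEStronglyMeasurable (fderiv ℝ x) (volume.restrict S) := hF.1
  have hDF : MemLp (fun X => Dv (x X) ∘L fderiv ℝ x X) 2 (volume.restrict S) := by
    refine hDx.of_le_mul (c := K) ?_ ?_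
    · exact aestronglyMeasurable_ten_comp hDx.1 hFm
    · filter_upwards [hFK] with X hX
      refine (ContinuousLinearMap.opNorm_comp_le _ _).trans ?_
      rw [mul_comm]
      gcongr
  refine ⟨IntegrableOn.locallyIntegrableOn (hvx.integrable (by norm_num) : Integrable _ _),
    IntegrableOn.locallyIntegrableOn (hDF.integrable (by norm_num) : Integrable _ _), ?_⟩
  intro ψ hψ hψc hψS e
  have hψ1 : ContDiff ℝ 1 ψ := hψ.of_le (by exact_mod_cast le_top)
  have hDψ : MemLp (fun y => fderiv ℝ ψ y e) 2 (volume.restrict S) :=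
    ((hψ1.continuous_fderiv (by norm_num)).clm_apply continuous_const).memLp_of_hasCompactSupport
      (hψc.fderiv_apply ℝ e)
  have hψL : MemLp ψ 2 (volume.restrict S) := hψ.continuous.memLp_of_hasCompactSupport hψc
  have hφ1 : ∀ n, ContDiff ℝ 1 (φ n) := fun n => (hφ n).1.of_le (by exact_mod_cast le_top)
  have hφL : ∀ n, MemLp (φ n) 2 (volume.restrict Ω) := fun n =>
    (hφ1 n).continuous.memLp_of_hasCompactSupport (hφ n).2.1
  have hDφL : ∀ n, MemLp (fderiv ℝ (φ n)) 2 (volume.restrict Ω) := fun n =>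
    ((hφ1 n).continuous_fderiv (by norm_num)).memLp_of_hasCompactSupport ((hφ n).2.1.fderiv ℝ)
  have hcc : c ^ (1 / 2 : ℝ) ≠ ⊤ := ENNReal.rpow_ne_top_of_nonneg (by norm_num) hc
  -- Composition with `x` costs a factor `c ^ (1/2)` in `L²`, so `L²` convergence on `Ω` survives on
  -- `S`.
  have lim : ∀ {E : Type} [NormedAddCommGroup E] (f : ℕ → Vec d → E) (g : Vec d → E),
      (∀ n, AEStronglyMeasurable (f n) (volume.restrict Ω)) →
      AEStronglyMeasurable g (volume.restrict Ω) →
      (∀ n, eLpNorm (f n - g) 2 (volume.restrict Ω) ≤ ((1 / 2 : ℝ≥0) ^ n : ℝ≥0)) →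
      Tendsto (fun n => eLpNorm (fun X => f n (x X) - g (x X)) 2 (volume.restrict S)) atTop
        (𝓝 0) := by
    intro E _ f g hf hg hfg
    have h0 : Tendsto (fun n => c ^ (1 / 2 : ℝ) * eLpNorm (f n - g) 2 (volume.restrict Ω)) atTop
        (𝓝 0) := by
      simpa using ENNReal.Tendsto.const_mul (tendsto_zero_of_le_two_pow hfg) (Or.inr hcc)
    exact ENNReal.tendsto_zero_of_le h0 fun n =>
      eLpNorm_two_comp_le (f := f n - g) ((hf n).sub hg) hxm hle
  have hL := tendsto_integral_smul_of_eLpNorm_two hDψ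
    (fun n => (hφL n).comp_of_map_le hxm hc hle) hvx
    (lim φ v (fun n => (hφL n).1) hv.1.1.1 hφv)
  have happ : ∀ {A : Vec d → Ten d}, AEStronglyMeasurable A (volume.restrict S) →
      AEStronglyMeasurable (fun X => A X (fderiv ℝ x X e)) (volume.restrict S) := fun hA =>
    aestronglyMeasurable_ten_apply hA (hFm.apply_continuousLinearMap e)
  have hbd : ∀ A : Vec d → Ten d, ∀ᵐ X ∂(volume.restrict S),
      ‖A X (fderiv ℝ x X e)‖ ≤ (K * ‖e‖) * ‖A X‖ := fun A => by
    filter_upwards [hFK] with X hX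
    refine (ContinuousLinearMap.le_opNorm _ _).trans ?_
    rw [mul_comm]
    gcongr
    refine (ContinuousLinearMap.le_opNorm _ _).trans ?_
    gcongr
  have hDφx : ∀ n, MemLp (fun X => fderiv ℝ (φ n) (x X)) 2 (volume.restrict S) := fun n =>
    (hDφL n).comp_of_map_le hxm hc hle
  have hR := tendsto_integral_smul_of_eLpNorm_two hψL
    (f := fun n X => fderiv ℝ (φ n) (x X) (fderiv ℝ x X e))
    (g := fun X => Dv (x X) (fderiv ℝ x X e))
    (fun n => (hDφx n).of_le_mul (happ (hDφx n).1) (hbd _))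
    (hDx.of_le_mul (happ hDx.1) (hbd _)) (by
      have h0 : Tendsto (fun n => ENNReal.ofReal (K * ‖e‖) *
          eLpNorm (fun X => fderiv ℝ (φ n) (x X) - Dv (x X)) 2 (volume.restrict S)) atTop
          (𝓝 0) := by
        have := ENNReal.Tendsto.const_mul (lim (fun n => fderiv ℝ (φ n)) Dv
          (fun n => (hDφL n).1) hv.1.2.1.1 hφD)
          (Or.inr (ENNReal.ofReal_ne_top (r := K * ‖e‖)))
        rwa [mul_zero] at this
      refine ENNReal.tendsto_zero_of_le h0 fun n => ?_
      refine eLpNorm_le_mul_eLpNorm_of_ae_le_mul ?_ 2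
      filter_upwards [hbd fun X => fderiv ℝ (φ n) (x X) - Dv (x X)] with X hX using hX)
  refine tendsto_nhds_unique hL ?_
  -- For smooth `φ n` the composite is Lipschitz, so its weak gradient is the classical one; the
  -- pointwise chain rule computes it wherever `x` is differentiable, which is a.e. by Rademacher.
  have heq : ∀ n, ∫ X in S, (fderiv ℝ ψ X e) • φ n (x X) =
      - ∫ X in S, ψ X • fderiv ℝ (φ n) (x X) (fderiv ℝ x X e) := fun n => by
    obtain ⟨C, hC⟩ := (hφ1 n).lipschitzWith_of_hasCompactSupport (hφ n).2.1 (by norm_num)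
    have hlip : LipschitzOnWith (C * K) (fun X => φ n (x X)) S :=
      hC.comp_lipschitzOnWith hx
    rw [(hasWeakGrad_fderiv_of_lipschitzOn hS hSb hlip).2.2 ψ hψ hψc hψS e]
    congr 1
    refine integral_congr_ae ?_
    filter_upwards [hx.ae_differentiableAt_of_isOpen hS] with X hX
    have hd : DifferentiableAt ℝ (φ n) (x X) := (hφ1 n).differentiable (by norm_num) _
    have := fderiv_comp X hd hX
    rw [show (fun X => φ n (x X)) = φ n ∘ x from rfl, this]
    rfl
  simp only [heq]
  exact hR.neg

/-- Uniqueness of weak gradients, in a fixed direction. -/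
lemma ae_eq_of_forall_integral_smul_eq {d : ℕ} {S : Set (Vec d)} (hS : IsOpen S)
    {f g : Vec d → Vec d} (hf : IntegrableOn f S) (hg : IntegrableOn g S)
    (h : ∀ φ : Vec d → ℝ, ContDiff ℝ ∞ φ → HasCompactSupport φ → tsupport φ ⊆ S →
      ∫ y in S, φ y • f y = ∫ y in S, φ y • g y) : ∀ᵐ y ∂(volume.restrict S), f y = g y := by
  have h0 := hS.ae_eq_zero_of_integral_contDiff_smul_eq_zero (μ := volume.restrict S)
    (f := fun y => f y - g y) ?_ ?_
  · filter_upwards [h0, ae_restrict_mem hS.measurableSet] with y hy hyS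
    exact sub_eq_zero.1 (hy hyS)
  · exact (hf.sub hg).integrableOn.locallyIntegrableOn
  · intro φ hφ hφc hφS
    obtain ⟨C, hC⟩ := hφ.continuous.bounded_above_of_compact_support hφc
    have hb : ∀ {u : Vec d → Vec d}, IntegrableOn u S →
        Integrable (fun y => φ y • u y) (volume.restrict S) := fun hu =>
      hu.bdd_smul C hφ.continuous.aestronglyMeasurable (Eventually.of_forall hC)
    simp only [smul_sub]
    rw [integral_sub (hb hf) (hb hg), h φ hφ hφc hφS, sub_self]

end WeakGradient

/-! ### Sobolev embedding and cancellation of the convection term. -/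

section Convection

open Filter Topology

lemma tr_eq_sum {d : ℕ} (A : Ten d) : tr A = ∑ j, (A (EuclideanSpace.single j 1)) j := by
  unfold tr
  rw [LinearMap.trace_eq_sum_inner _ (EuclideanSpace.basisFun (Fin d) ℝ)]
  simp [EuclideanSpace.inner_single_left]

lemma exists_eLpNorm_le_eLpNorm_fderiv {d : ℕ} {Ω : Set (Vec d)} (hΩ : Bornology.IsBounded Ω)
    {p q : ℝ≥0} (hp : 1 ≤ p) (hpd : p < d) (hpq : (p : ℝ)⁻¹ - (d : ℝ)⁻¹ ≤ (q : ℝ)⁻¹) :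
    ∃ C : ℝ≥0, ∀ φ : Vec d → Vec d, ContDiff ℝ 1 φ → tsupport φ ⊆ Ω →
      eLpNorm φ q volume ≤ C * eLpNorm (fderiv ℝ φ) p volume := by
  have h1 : p < Module.finrank ℝ (Vec d) := by rwa [finrank_euclideanSpace, Fintype.card_fin]
  have h2 : (p : ℝ)⁻¹ - (Module.finrank ℝ (Vec d) : ℝ)⁻¹ ≤ (q : ℝ)⁻¹ := by
    rwa [finrank_euclideanSpace, Fintype.card_fin]
  exact ⟨_, fun φ hφ hφΩ => eLpNorm_le_eLpNorm_fderiv_of_le volume hφ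
      ((subset_tsupport φ).trans hφΩ) hp h1 h2 hΩ⟩

/-- The Sobolev inequality requires `p < d`, which excludes `p = 2` in the plane. On a bounded set a
smaller `p` serves, since Hölder bounds the `L^p` norm of the gradient by its `L²` norm. -/
lemma exists_eLpNorm_le_eLpNorm_fderiv_two {d : ℕ} {Ω : Set (Vec d)}
    (hΩ : Bornology.IsBounded Ω)
    {p q : ℝ≥0} (hp : 1 ≤ p) (hpd : p < d) (hpq : (p : ℝ)⁻¹ - (d : ℝ)⁻¹ ≤ (q : ℝ)⁻¹) (hp2 : p ≤ 2) :
    ∃ C : ℝ≥0, ∀ φ : Vec d → Vec d, ContDiff ℝ 1 φ → tsupport φ ⊆ Ω →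
      eLpNorm φ q (volume.restrict Ω) ≤ C * eLpNorm (fderiv ℝ φ) 2 (volume.restrict Ω) := by
  have := isFiniteMeasure_restrict_of_isBounded hΩ
  have hcT : volume.restrict Ω univ ^
      (1 / (p : ENNReal).toReal - 1 / (2 : ENNReal).toReal) ≠ ⊤ := by
    refine ENNReal.rpow_ne_top_of_nonneg (sub_nonneg.2 ?_) (measure_ne_top _ _)
    have h1 : (1 : ℝ) ≤ p := by exact_mod_cast hp
    have h2 : (p : ℝ) ≤ 2 := by exact_mod_cast hp2
    rw [ENNReal.coe_toReal, ENNReal.toReal_ofNat]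
    exact one_div_le_one_div_of_le (by linarith) h2
  obtain ⟨c, hc⟩ : ∃ c : ℝ≥0, (c : ENNReal) = _ := ⟨_, ENNReal.coe_toNNReal hcT⟩
  obtain ⟨C₀, hC₀⟩ := exists_eLpNorm_le_eLpNorm_fderiv hΩ hp hpd hpq
  refine ⟨C₀ * c, fun φ hφ hφΩ => ?_⟩
  have h1 := hC₀ φ hφ hφΩ
  have hs : Function.support (fun y => ‖fderiv ℝ φ y‖) ⊆ Ω := fun y hy =>
    hφΩ (support_fderiv_subset ℝ fun h => hy (by simp [h]))
  have h2 : eLpNorm (fderiv ℝ φ) p volume = eLpNorm (fderiv ℝ φ) p (volume.restrict Ω) := by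
    rw [← eLpNorm_norm, ← eLpNorm_norm (μ := volume.restrict Ω),
      eLpNorm_restrict_eq_of_support_subset hs]
  have h3 : eLpNorm (fderiv ℝ φ) p (volume.restrict Ω) ≤
      eLpNorm (fderiv ℝ φ) 2 (volume.restrict Ω) * c := by
    rw [hc]
    exact eLpNorm_le_eLpNorm_mul_rpow_measure_univ (by exact_mod_cast hp2)
      (hφ.continuous_fderiv (by norm_num)).aestronglyMeasurable
  refine (eLpNorm_mono_measure _ Measure.restrict_le_self).trans (h1.trans ?_)
  rw [h2, ENNReal.coe_mul, mul_assoc, mul_comm (c : ENNReal)]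
  exact mul_le_mul_right h3 _

/-- The Sobolev embedding `H¹₀ ⊂ L⁴` in dimensions two and three. -/
lemma exists_eLpNorm_four_le {d : ℕ} (hd : d = 2 ∨ d = 3) {Ω : Set (Vec d)}
    (hΩ : Bornology.IsBounded Ω) : ∃ C : ℝ≥0, ∀ φ : Vec d → Vec d, ContDiff ℝ 1 φ →
      tsupport φ ⊆ Ω →
      eLpNorm φ 4 (volume.restrict Ω) ≤ C * eLpNorm (fderiv ℝ φ) 2 (volume.restrict Ω) := by
  -- `p = 12/7` has Sobolev conjugate exactly `4` when `d = 3`, as `7/12 - 1/3 = 1/4`. It lies below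
  -- `2`, so it is also allowed when `d = 2`, where `7/12 - 1/2 ≤ 1/4`.
  have h := exists_eLpNorm_le_eLpNorm_fderiv_two (p := 12 / 7) (q := 4) hΩ
    (by rw [← NNReal.coe_le_coe]; norm_num)
    (by rw [← NNReal.coe_lt_coe]; rcases hd with rfl | rfl <;> norm_num)
    (by rcases hd with rfl | rfl <;> norm_num)
    (by rw [← NNReal.coe_le_coe]; norm_num)
  rwa [ENNReal.coe_ofNat] at h

/-- An `H¹₀` field is an `L⁴` limit of any sequence of test fields approximating it in `H¹`. -/
lemma tendsto_eLpNorm_four {d : ℕ} (hd : d = 2 ∨ d = 3) {Ω : Set (Vec d)}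
    (hΩ : Bornology.IsBounded Ω) {v : Vec d → Vec d} {Dv : Vec d → Ten d}
    (hv : MemH1 Ω v Dv) {φ : ℕ → Vec d → Vec d}
    (hφ : ∀ n, ContDiff ℝ ∞ (φ n) ∧ HasCompactSupport (φ n) ∧ tsupport (φ n) ⊆ Ω)
    (hφv : ∀ n, eLpNorm (φ n - v) 2 (volume.restrict Ω) ≤ ((1 / 2 : ℝ≥0) ^ n : ℝ≥0))
    (hφD : ∀ n, eLpNorm (fderiv ℝ (φ n) - Dv) 2 (volume.restrict Ω) ≤ ((1 / 2 : ℝ≥0) ^ n : ℝ≥0)) :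
    MemLp v 4 (volume.restrict Ω) ∧
      Tendsto (fun n => eLpNorm (φ n - v) 4 (volume.restrict Ω)) atTop (𝓝 0) := by
  have := isFiniteMeasure_restrict_of_isBounded hΩ
  obtain ⟨C, hC⟩ := exists_eLpNorm_four_le hd hΩ
  have hφ1 : ∀ n, ContDiff ℝ 1 (φ n) := fun n => (hφ n).1.of_le (by exact_mod_cast le_top)
  have hDm : ∀ n, AEStronglyMeasurable (fderiv ℝ (φ n)) (volume.restrict Ω) := fun n =>
    ((hφ1 n).continuous_fderiv (by norm_num)).aestronglyMeasurable
  have hφ4 : ∀ n, MemLp (φ n) 4 (volume.restrict Ω) := fun n =>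
    (hφ1 n).continuous.memLp_of_hasCompactSupport (hφ n).2.1
  -- Two gradients, each within `2⁻ᴺ` of `Dv`, differ by at most `2 * 2⁻ᴺ`; the embedding
  -- contributes `C`, and the extra `1` makes the bound strict.
  set B : ℕ → ℝ≥0 := fun N => (2 * C + 1) * (1 / 2) ^ N
  have hB : ∑' N, (B N : ENNReal) ≠ ⊤ := by
    rw [ENNReal.tsum_coe_ne_top_iff_summable]
    refine (NNReal.summable_geometric ?_).mul_left _
    rw [← NNReal.coe_lt_coe]; norm_num
  have hcau : ∀ N n m : ℕ, N ≤ n → N ≤ m →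
      eLpNorm (φ n - φ m) 4 (volume.restrict Ω) < B N := by
    intro N n m hn hm
    have hpow : ∀ k, N ≤ k → ((1 / 2 : ℝ≥0) ^ k : ℝ≥0) ≤ (1 / 2) ^ N := fun k hk =>
      pow_le_pow_of_le_one zero_le (by rw [← NNReal.coe_le_coe]; norm_num) hk
    have h1 := hC (φ n - φ m) ((hφ1 n).sub (hφ1 m))
      ((tsupport_sub _ _).trans (union_subset (hφ n).2.2 (hφ m).2.2))
    have h2 : fderiv ℝ (φ n - φ m) = (fderiv ℝ (φ n) - Dv) - (fderiv ℝ (φ m) - Dv) := by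
      ext1 y
      rw [fderiv_sub ((hφ1 n).differentiable (by norm_num) y)
        ((hφ1 m).differentiable (by norm_num) y)]
      simp
    have h3 : eLpNorm (fderiv ℝ (φ n - φ m)) 2 (volume.restrict Ω) ≤
        (((1 / 2) ^ N + (1 / 2) ^ N : ℝ≥0) : ENNReal) := by
      rw [h2]
      refine (eLpNorm_sub_le ((hDm n).sub hv.2.1.1) ((hDm m).sub hv.2.1.1) (by norm_num)).trans ?_
      rw [ENNReal.coe_add]
      exact add_le_add ((hφD n).trans (ENNReal.coe_le_coe.2 (hpow n hn)))
        ((hφD m).trans (ENNReal.coe_le_coe.2 (hpow m hm)))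
    refine (h1.trans (mul_le_mul_right h3 _)).trans_lt ?_
    rw [← ENNReal.coe_mul, ENNReal.coe_lt_coe, ← NNReal.coe_lt_coe]
    simp only [B]
    push_cast
    have : (0 : ℝ) < (1 / 2) ^ N := by positivity
    nlinarith
  obtain ⟨w, hw, hlim⟩ := Lp.cauchy_complete_eLpNorm (by norm_num) hφ4 hB hcau
  -- On a set of finite measure `L⁴` convergence implies `L²` convergence, so the two limits of `φ
  -- n` coincide.
  have hwv : w =ᵐ[volume.restrict Ω] v := by
    have hle : eLpNorm (w - v) 2 (volume.restrict Ω) ≤ 0 := by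
      refine ge_of_tendsto' (x := atTop) (f := fun n : ℕ =>
        eLpNorm (φ n - w) 4 (volume.restrict Ω) * volume.restrict Ω univ ^
          (1 / (2 : ENNReal).toReal - 1 / (4 : ENNReal).toReal) +
        eLpNorm (φ n - v) 2 (volume.restrict Ω)) ?_ fun n => ?_
      · have h1 := ENNReal.Tendsto.mul_const hlim
          (Or.inr (ENNReal.rpow_ne_top_of_nonneg (y := 1 / (2 : ENNReal).toReal -
            1 / (4 : ENNReal).toReal) (by norm_num) (measure_ne_top (volume.restrict Ω) univ)))
        rw [zero_mul] at h1
        simpa using h1.add (tendsto_zero_of_le_two_pow hφv)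
      · have h1 : w - v = (φ n - v) - (φ n - w) := by ext1; simp
        rw [h1, add_comm]
        refine (eLpNorm_sub_le ((hφ4 n).1.sub hv.1.1) ((hφ4 n).1.sub hw.1) (by norm_num)).trans ?_
        gcongr
        exact eLpNorm_le_eLpNorm_mul_rpow_measure_univ (by norm_num) ((hφ4 n).1.sub hw.1)
    have h0 := (eLpNorm_eq_zero_iff (hw.1.sub hv.1.1) (by norm_num)).1 (le_antisymm hle zero_le)
    filter_upwards [h0] with y hy
    exact sub_eq_zero.1 hy
  refine ⟨(memLp_congr_ae hwv).1 hw, ?_⟩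
  refine hlim.congr fun n => eLpNorm_congr_ae ?_
  filter_upwards [hwv] with y hy
  simp [hy]

instance : ENNReal.HolderTriple 4 4 2 := ⟨by
  rw [← ENNReal.toReal_eq_toReal_iff' (by simp) (by simp)]
  rw [ENNReal.toReal_add (by simp) (by simp)]
  norm_num⟩

/-- Hölder with `1/2 + 1/4 + 1/4 = 1`; this is why `L⁴` is the target of the embedding. -/
lemma eLpNorm_one_inner_apply_le {α : Type*} [MeasurableSpace α] {μ : Measure α} {d : ℕ}
    {A : α → Ten d} {a b : α → Vec d} (hA : AEStronglyMeasurable A μ)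
    (ha : AEStronglyMeasurable a μ) (hb : AEStronglyMeasurable b μ) :
    eLpNorm (fun y => inner ℝ (A y (a y)) (b y)) 1 μ ≤
      eLpNorm A 2 μ * (eLpNorm a 4 μ * eLpNorm b 4 μ) := by
  have h1 : eLpNorm (fun y => inner ℝ (A y (a y)) (b y)) 1 μ ≤
      eLpNorm ((fun y => ‖A y‖) • ((fun y => ‖a y‖) • fun y => ‖b y‖)) 1 μ := by
    refine eLpNorm_mono fun y => ?_
    refine (norm_inner_le_norm _ _).trans ?_
    change _ ≤ ‖‖A y‖ * (‖a y‖ * ‖b y‖)‖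
    rw [← mul_assoc, norm_mul, norm_mul, norm_norm, norm_norm, norm_norm]
    gcongr
    exact (A y).le_opNorm _
  refine h1.trans ((eLpNorm_smul_le_mul_eLpNorm (p := 2) (q := 2) (ha.norm.smul hb.norm)
    hA.norm).trans ?_)
  rw [eLpNorm_norm]
  gcongr
  refine (eLpNorm_smul_le_mul_eLpNorm (p := 4) (q := 4) hb.norm ha.norm).trans ?_
  rw [eLpNorm_norm, eLpNorm_norm]

/-- The convection term of a divergence free field against a test field vanishes. -/
lemma integral_convection_testField_eq_zero {d : ℕ} {Ω : Set (Vec d)}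
    {v φ : Vec d → Vec d} {Dv : Vec d → Ten d} (hv : MemH1 Ω v Dv)
    (hdiv : ∀ᵐ y ∂(volume.restrict Ω), tr (Dv y) = 0)
    (hφ : ContDiff ℝ ∞ φ) (hφc : HasCompactSupport φ) (hφΩ : tsupport φ ⊆ Ω) :
    ∫ y in Ω, inner ℝ (fderiv ℝ φ y (v y)) (φ y) = 0 := by
  -- `(v · ∇)φ · φ = v · ∇ψ`, and `ψ` is an admissible scalar test function for the weak gradient of
  -- `v`; summing over coordinates leaves `-∫ ψ div v`.
  set ψ : Vec d → ℝ := fun y => ‖φ y‖ ^ 2 / 2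
  have hψ : ContDiff ℝ ∞ ψ := (hφ.norm_sq ℝ).div_const 2
  have hψ1 : ContDiff ℝ 1 ψ := hψ.of_le (by exact_mod_cast le_top)
  have hψs : Function.support ψ ⊆ Function.support φ := fun y hy hφy => hy (by simp [ψ, hφy])
  have hψt : tsupport ψ ⊆ tsupport φ := closure_mono hψs
  have hψc : HasCompactSupport ψ := hφc.mono hψs
  have hD : ∀ y e, fderiv ℝ ψ y e = inner ℝ (fderiv ℝ φ y e) (φ y) := fun y e => by
    have hd : HasFDerivAt φ (fderiv ℝ φ y) y :=
      (hφ.differentiable (by simp) y).hasFDerivAt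
    have := (hd.norm_sq.mul_const (2⁻¹ : ℝ)).fderiv
    have h2 : ψ = fun y => ‖φ y‖ ^ 2 * 2⁻¹ := by ext1; simp [ψ, div_eq_mul_inv]
    rw [h2, this]
    simp [real_inner_comm]
  have hDc : ∀ e, Continuous fun y => fderiv ℝ ψ y e := fun e =>
    (hψ1.continuous_fderiv (by norm_num)).clm_apply continuous_const
  have hL : ∀ e, MemLp (fun y => fderiv ℝ ψ y e) 2 (volume.restrict Ω) := fun e =>
    (hDc e).memLp_of_hasCompactSupport (hψc.fderiv_apply ℝ e)
  have hψL : MemLp ψ 2 (volume.restrict Ω) := hψ.continuous.memLp_of_hasCompactSupport hψc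
  have hi1 : ∀ e, Integrable (fun y => (fderiv ℝ ψ y e) • v y) (volume.restrict Ω) := fun e =>
    memLp_one_iff_integrable.1 (hv.1.smul (hL e))
  have hDe : ∀ e, MemLp (fun y => Dv y e) 2 (volume.restrict Ω) := fun e =>
    (ContinuousLinearMap.apply ℝ (Vec d) e).comp_memLp' hv.2.1
  have hi2 : ∀ e, Integrable (fun y => ψ y • Dv y e) (volume.restrict Ω) := fun e =>
    memLp_one_iff_integrable.1 ((hDe e).smul hψL)
  have hp : ∀ (j : Fin d) {f : Vec d → Vec d}, Integrable f (volume.restrict Ω) →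
      Integrable (fun y => f y j) (volume.restrict Ω) := fun j _ hf =>
    (EuclideanSpace.proj (𝕜 := ℝ) j).integrable_comp hf
  have hj : ∀ j : Fin d, ∫ y in Ω, fderiv ℝ ψ y (EuclideanSpace.single j 1) * v y j =
      - ∫ y in Ω, ψ y * (Dv y (EuclideanSpace.single j 1)) j := fun j => by
    have := congrArg (fun z : Vec d => z j)
      (hv.2.2.2.2 ψ hψ hψc (hψt.trans hφΩ) (EuclideanSpace.single j 1))
    simp only [PiLp.neg_apply] at this
    rw [eval_integral_piLp fun i => hp i (hi1 _), eval_integral_piLp fun i => hp i (hi2 _)] at this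
    exact this
  have hsum : ∀ y, inner ℝ (fderiv ℝ φ y (v y)) (φ y) =
      ∑ j, fderiv ℝ ψ y (EuclideanSpace.single j 1) * v y j := fun y => by
    rw [← hD]
    conv_lhs => rw [← (EuclideanSpace.basisFun (Fin d) ℝ).sum_repr (v y)]
    simp [mul_comm]
  simp only [hsum]
  have hI1 : ∀ j : Fin d, Integrable (fun y => fderiv ℝ ψ y (EuclideanSpace.single j 1) * v y j)
      (volume.restrict Ω) := fun j => hp j (hi1 _)
  have hI2 : ∀ j : Fin d, Integrable (fun y => ψ y * (Dv y (EuclideanSpace.single j 1)) j)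
      (volume.restrict Ω) := fun j => hp j (hi2 _)
  rw [integral_finsetSum _ fun j _ => hI1 j]
  simp only [hj]
  rw [Finset.sum_neg_distrib,
    ← integral_finsetSum _ fun j _ => hI2 j, neg_eq_zero]
  refine integral_eq_zero_of_ae ?_
  filter_upwards [hdiv] with y hy
  rw [← Finset.mul_sum, ← tr_eq_sum, hy]
  simp

/-- The convection term does no work on a divergence free `H¹₀` field. -/
lemma integral_convection_self_eq_zero {d : ℕ} (hd : d = 2 ∨ d = 3) {Ω : Set (Vec d)}
    (hΩ : Bornology.IsBounded Ω) {v : Vec d → Vec d} {Dv : Vec d → Ten d} (hv : MemH10 Ω v Dv)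
    (hdiv : ∀ᵐ y ∂(volume.restrict Ω), tr (Dv y) = 0) :
    ∫ y in Ω, inner ℝ (Dv y (v y)) (v y) = 0 := by
  have := isFiniteMeasure_restrict_of_isBounded hΩ
  obtain ⟨φ, hφ, hφv, hφD⟩ := hv.exists_seq
  obtain ⟨hv4, hlim⟩ := tendsto_eLpNorm_four hd hΩ hv.1 hφ hφv hφD
  have hφ1 : ∀ n, ContDiff ℝ 1 (φ n) := fun n => (hφ n).1.of_le (by exact_mod_cast le_top)
  have hDφ : ∀ n, MemLp (fderiv ℝ (φ n)) 2 (volume.restrict Ω) := fun n =>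
    ((hφ1 n).continuous_fderiv (by norm_num)).memLp_of_hasCompactSupport ((hφ n).2.1.fderiv ℝ)
  have hφ4 : ∀ n, MemLp (φ n) 4 (volume.restrict Ω) := fun n =>
    (hφ1 n).continuous.memLp_of_hasCompactSupport (hφ n).2.1
  have hD := hv.1.2.1
  have hm : ∀ {A : Vec d → Ten d} {b : Vec d → Vec d},
      AEStronglyMeasurable A (volume.restrict Ω) → AEStronglyMeasurable b (volume.restrict Ω) →
      AEStronglyMeasurable (fun y => inner ℝ (A y (v y)) (b y)) (volume.restrict Ω) :=
    fun hA hb => (aestronglyMeasurable_ten_apply hA hv4.1).inner hb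
  have hint : ∀ {A : Vec d → Ten d} {b : Vec d → Vec d}, MemLp A 2 (volume.restrict Ω) →
      MemLp b 4 (volume.restrict Ω) →
      Integrable (fun y => inner ℝ (A y (v y)) (b y)) (volume.restrict Ω) := fun hA hb =>
    memLp_one_iff_integrable.1 ⟨hm hA.1 hb.1,
      (eLpNorm_one_inner_apply_le hA.1 hv4.1 hb.1).trans_lt
        (ENNReal.mul_lt_top hA.2 (ENNReal.mul_lt_top hv4.2 hb.2))⟩
  -- Only the transported field is approximated. The advecting field stays `v`, because the `φ n`
  -- need not be divergence free.
  have hT : Tendsto (fun n => ∫ y in Ω, inner ℝ (fderiv ℝ (φ n) y (v y)) (φ n y)) atTop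
      (𝓝 (∫ y in Ω, inner ℝ (Dv y (v y)) (v y))) := by
    refine tendsto_integral_of_L1' _ (hm hD.1 hv4.1)
      (Eventually.of_forall fun n => hint (hDφ n) (hφ4 n)) ?_
    set M := eLpNorm v 4 (volume.restrict Ω)
    have hM : M ≠ ⊤ := hv4.2.ne
    have h0 : Tendsto (fun n =>
        eLpNorm (fderiv ℝ (φ n) - Dv) 2 (volume.restrict Ω) *
          (M * (eLpNorm (φ n - v) 4 (volume.restrict Ω) + M)) +
        eLpNorm Dv 2 (volume.restrict Ω) * (M * eLpNorm (φ n - v) 4 (volume.restrict Ω)))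
        atTop (𝓝 (0 * (M * (0 + M)) + eLpNorm Dv 2 (volume.restrict Ω) * (M * 0))) := by
      refine Tendsto.add (ENNReal.Tendsto.mul (tendsto_zero_of_le_two_pow hφD) (Or.inr ?_)
        (ENNReal.Tendsto.const_mul (hlim.add_const M) (Or.inr hM)) (Or.inr (by simp)))
        (ENNReal.Tendsto.const_mul (ENNReal.Tendsto.const_mul hlim (Or.inr hM)) (Or.inr hD.2.ne))
      rw [zero_add]
      exact ENNReal.mul_ne_top hM hM
    simp only [zero_mul, mul_zero, add_zero] at h0
    refine ENNReal.tendsto_zero_of_le h0 fun n => ?_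
    have hsplit : ((fun y => inner ℝ (fderiv ℝ (φ n) y (v y)) (φ n y)) -
        fun y => inner ℝ (Dv y (v y)) (v y)) =
        (fun y => inner ℝ ((fderiv ℝ (φ n) - Dv) y (v y)) (φ n y)) +
          fun y => inner ℝ (Dv y (v y)) ((φ n - v) y) := by
      ext1 y
      simp [inner_sub_left, inner_sub_right]
    rw [hsplit]
    refine (eLpNorm_add_le (hm ((hDφ n).1.sub hD.1) (hφ4 n).1)
      (hm hD.1 ((hφ4 n).1.sub hv4.1)) le_rfl).trans (add_le_add ?_ ?_)
    · refine (eLpNorm_one_inner_apply_le ((hDφ n).1.sub hD.1) hv4.1 (hφ4 n).1).trans ?_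
      gcongr
      calc eLpNorm (φ n) 4 (volume.restrict Ω)
          = eLpNorm ((φ n - v) + v) 4 (volume.restrict Ω) := by rw [sub_add_cancel]
        _ ≤ _ := eLpNorm_add_le ((hφ4 n).1.sub hv4.1) hv4.1 (by norm_num)
    · exact eLpNorm_one_inner_apply_le hD.1 hv4.1 ((hφ4 n).1.sub hv4.1)
  refine tendsto_nhds_unique hT ?_
  simp only [fun n => integral_convection_testField_eq_zero hv.1 hdiv (hφ n).1 (hφ n).2.1
    (hφ n).2.2]
  exact tendsto_const_nhds

end Convection

/-! ### Evolution of the deformation gradient. -/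

section Kinematics

open Filter Topology

/-- The integral formula for `x(t)` has an exceptional null set depending on `t`. Along a sequence
of times these sets have a null union, so convergence holds at points `Y` arbitrarily close to `X`;
the Lipschitz bound, uniform in time, carries it to `X` itself. -/
lemma continuousOn_time_of_hasTimeDeriv {d : ℕ} {T : ℝ} {S : Set (Vec d)}
    {x U : ℝ → Vec d → Vec d} (h : HasTimeDeriv T S x U) (hT : 0 ≤ T) (hS : IsOpen S) {K : ℝ≥0}
    (hx : ∀ t ∈ Icc 0 T, LipschitzOnWith K (x t) S) {X : Vec d} (hX : X ∈ S) :
    ContinuousOn (fun t => x t X) (Icc 0 T) := by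
  obtain ⟨w, -, -, -, hxw, hw⟩ := h.exists_primitive hT
  intro t ht
  refine tendsto_of_seq_tendsto fun τ hτ => ?_
  have hτt : Tendsto τ atTop (𝓝 t) := hτ.mono_right nhdsWithin_le_nhds
  have hτm : ∀ᶠ n in atTop, τ n ∈ Icc 0 T := hτ.eventually self_mem_nhdsWithin
  have hae : ∀ᵐ Y ∂(volume.restrict S), Tendsto (fun n => x (τ n) Y) atTop (𝓝 (x t Y)) := by
    have h1 : ∀ᵐ Y ∂(volume.restrict S), ∀ n, τ n ∈ Icc 0 T → x (τ n) Y = w (τ n) Y := by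
      rw [ae_all_iff]
      intro n
      by_cases hn : τ n ∈ Icc 0 T
      · filter_upwards [hxw _ hn] with Y hY _ using hY
      · exact Eventually.of_forall fun Y h => absurd h hn
    filter_upwards [h1, hxw t ht, hw] with Y hY1 hY2 hY3
    have hc : ContinuousOn (fun s => w s Y) (Icc 0 T) := by
      have hp : ContinuousOn (fun s => w 0 Y + ∫ r in (0 : ℝ)..s, U r Y) (Icc 0 T) := by
        refine continuousOn_const.add ?_
        have := intervalIntegral.continuousOn_primitive_interval'
          (b₁ := 0) (b₂ := T) hY3.1 (a := 0) (by simp)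
        rwa [uIcc_of_le hT] at this
      exact hp.congr fun s hs => hY3.2 s hs
    rw [hY2]
    refine ((hc t ht).tendsto.comp hτ).congr' ?_
    filter_upwards [hτm] with n hn using (hY1 n hn).symm
  rw [Metric.tendsto_atTop']
  intro ε hε
  -- Moving from `X` to `Y` costs at most `ε / 4` at each of the two times; `K + 1` avoids dividing
  -- by zero.
  set δ : ℝ := ε / (4 * (K + 1))
  have hδ : 0 < δ := by positivity
  have hpos : 0 < volume (S ∩ Metric.ball X δ) :=
    (hS.inter Metric.isOpen_ball).measure_pos volume ⟨X, hX, Metric.mem_ball_self hδ⟩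
  obtain ⟨Y, hYS, hY⟩ : ∃ Y ∈ S ∩ Metric.ball X δ,
      Tendsto (fun n => x (τ n) Y) atTop (𝓝 (x t Y)) := by
    by_contra hcon
    push Not at hcon
    refine hpos.ne' (measure_mono_null (fun Y hY => ?_)
      ((ae_restrict_iff' hS.measurableSet).1 hae))
    simp only [mem_compl_iff, mem_ofPred_eq, Classical.not_imp]
    exact ⟨hY.1, hcon Y hY⟩
  have hbd : ∀ s ∈ Icc 0 T, dist (x s X) (x s Y) ≤ ε / 4 := fun s hs => by
    refine ((hx s hs).dist_le_mul X hX Y hYS.1).trans ?_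
    have h1 : dist X Y ≤ δ := by rw [dist_comm]; exact (Metric.mem_ball.1 hYS.2).le
    calc (K : ℝ) * dist X Y ≤ (K + 1) * δ := by gcongr; linarith
      _ = ε / 4 := by simp only [δ]; field_simp
  have hev : ∀ᶠ n in atTop, dist (x (τ n) X) (x t X) < ε := by
    filter_upwards [hτm, (Metric.tendsto_nhds.1 hY) (ε / 4) (by positivity)] with n hn hnY
    have h1 := hbd _ hn
    have h2 := hbd t ht
    have h3 := dist_triangle4 (x (τ n) X) (x (τ n) Y) (x t Y) (x t X)
    rw [dist_comm (x t Y)] at h3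
    linarith
  obtain ⟨N, hN⟩ := eventually_atTop.1 hev
  exact ⟨N, fun n hn => hN n hn.le⟩

lemma continuousOn_uncurry_of_hasTimeDeriv {d : ℕ} {T : ℝ} {S : Set (Vec d)}
    {x U : ℝ → Vec d → Vec d} (h : HasTimeDeriv T S x U) (hT : 0 ≤ T) (hS : IsOpen S) {K : ℝ≥0}
    (hx : ∀ t ∈ Icc 0 T, LipschitzOnWith K (x t) S) :
    ContinuousOn (Function.uncurry x) (Icc 0 T ×ˢ S) :=
  continuousOn_prod_of_continuousOn_lipschitzOnWith' _ K hx
    fun _ hX => continuousOn_time_of_hasTimeDeriv h hT hS hx hX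

open Classical in
lemma measurable_indicator_of_continuousOn {d : ℕ} {s : Set (ℝ × Vec d)} {f : ℝ × Vec d → Vec d}
    (hs : MeasurableSet s) (hf : ContinuousOn f s) : Measurable (s.indicator f) := by
  rw [← piecewise_eq_indicator]
  exact hf.measurable_piecewise continuousOn_const hs

/-- The directional derivatives of a continuous family of Lipschitz maps have a jointly measurable
representative. -/
lemma exists_stronglyMeasurable_fderiv_apply {d : ℕ} {T : ℝ} {S : Set (Vec d)}
    {x : ℝ → Vec d → Vec d} (hS : IsOpen S) {K : ℝ≥0}
    (hx : ∀ t ∈ Icc 0 T, LipschitzOnWith K (x t) S)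
    (hc : ContinuousOn (Function.uncurry x) (Icc 0 T ×ˢ S)) (e : Vec d) :
    ∃ L : ℝ → Vec d → Vec d, StronglyMeasurable (Function.uncurry L) ∧
      ∀ s ∈ Icc 0 T, ∀ᵐ X ∂(volume.restrict S), L s X = fderiv ℝ (x s) X e := by
  set y := (Icc 0 T ×ˢ S).indicator (Function.uncurry x)
  have hy : Measurable y :=
    measurable_indicator_of_continuousOn (measurableSet_Icc.prod hS.measurableSet) hc
  have hyx : ∀ s ∈ Icc 0 T, ∀ X ∈ S, y (s, X) = x s X := fun s hs X hX =>
    indicator_of_mem (mk_mem_prod hs hX) _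
  -- Difference quotients with step `1 / (n + 1)`. The arbitrary value of `limUnder` at points of
  -- divergence matters only on a null subset of `S` for each `s` in `[0, T]`.
  set q : ℕ → ℝ × Vec d → Vec d := fun n z =>
    ((n : ℝ) + 1) • (y (z.1, z.2 + ((n : ℝ) + 1)⁻¹ • e) - y z)
  refine ⟨fun s X => limUnder atTop fun n => q n (s, X), ?_, fun s hs => ?_⟩
  · have : ∀ n, StronglyMeasurable (q n) := fun n => by
      refine Measurable.stronglyMeasurable ?_
      simp only [q]
      have h1 : Measurable fun z : ℝ × Vec d => y (z.1, z.2 + ((n : ℝ) + 1)⁻¹ • e) :=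
        hy.comp (by fun_prop)
      exact (h1.sub hy).const_smul ((n : ℝ) + 1)
    exact StronglyMeasurable.limUnder this
  · filter_upwards [(hx s hs).ae_differentiableAt_of_isOpen hS,
      ae_restrict_mem hS.measurableSet] with X hX hXS
    refine Tendsto.limUnder_eq ?_
    have heq : (fun Y => y (s, Y)) =ᶠ[𝓝 X] x s := by
      filter_upwards [hS.mem_nhds hXS] with Y hY using hyx s hs Y hY
    refine (hX.hasFDerivAt.congr_of_eventuallyEq heq).lim e ?_
    refine (tendsto_atTop_add_const_right _ 1 tendsto_natCast_atTop_atTop).congr fun n => ?_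
    rw [Real.norm_of_nonneg (by positivity)]

/-- Fubini's theorem for a time integral tested against a function of space. -/
lemma integral_smul_intervalIntegral {d : ℕ} {T t : ℝ} (ht : t ∈ Icc 0 T) {S : Set (Vec d)}
    [IsFiniteMeasure (volume.restrict S)] {h : ℝ → Vec d → Vec d} {c : Vec d → ℝ}
    (hh : MemLp (Function.uncurry h) 2
      ((volume.restrict (Ioc 0 T)).prod (volume.restrict S)))
    (hc : MemLp c 2 (volume.restrict S)) :
    Integrable (fun X => c X • ∫ s in (0 : ℝ)..t, h s X) (volume.restrict S) ∧
    ∫ X in S, c X • ∫ s in (0 : ℝ)..t, h s X = ∫ s in (0 : ℝ)..t, ∫ X in S, c X • h s X := by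
  have hint : Integrable (fun z : ℝ × Vec d => c z.2 • h z.1 z.2)
      ((volume.restrict (Ioc 0 t)).prod (volume.restrict S)) := by
    refine Integrable.mono_measure (ν := (volume.restrict (Ioc 0 T)).prod (volume.restrict S)) ?_
      (Measure.prod_mono (Measure.restrict_mono (Ioc_subset_Ioc_right ht.2) le_rfl) le_rfl)
    exact memLp_one_iff_integrable.1 (hh.smul (hc.comp_snd (volume.restrict (Ioc 0 T))))
  simp only [intervalIntegral.integral_of_le ht.1, ← integral_smul]
  exact ⟨hint.integral_prod_right, (integral_integral_swap hint).symm⟩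

/-- Slicewise null sets give a null set in the product only under measurability, which is supplied
by strongly measurable representatives. -/
lemma ae_prod_eq_of_ae_ae_eq {α β E : Type*} [MeasurableSpace α] [MeasurableSpace β]
    [NormedAddCommGroup E] {μ : Measure α} {ν : Measure β} [SFinite μ] [SFinite ν]
    {f g : α × β → E} (hf : AEStronglyMeasurable f (μ.prod ν))
    (hg : AEStronglyMeasurable g (μ.prod ν)) (h : ∀ᵐ s ∂μ, ∀ᵐ y ∂ν, f (s, y) = g (s, y)) :
    f =ᵐ[μ.prod ν] g := by
  have hm : hf.mk f =ᵐ[μ.prod ν] hg.mk g := by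
    refine (Measure.ae_prod_mem_iff_ae_ae_mem (s := {z | hf.mk f z = hg.mk g z})
      (hf.stronglyMeasurable_mk.measurableSet_eq_fun hg.stronglyMeasurable_mk)).2 ?_
    filter_upwards [h, Measure.ae_ae_of_ae_prod hf.ae_eq_mk, Measure.ae_ae_of_ae_prod hg.ae_eq_mk]
      with s h1 h2 h3
    filter_upwards [h1, h2, h3] with y h1 h2 h3
    rw [← h2, ← h3, h1]
  exact hf.ae_eq_mk.trans (hm.trans hg.ae_eq_mk.symm)

lemma ae_ae_swap_of_ae_prod {α β : Type*} [MeasurableSpace α] [MeasurableSpace β]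
    {μ : Measure α} {ν : Measure β} [SFinite μ] [SFinite ν] {p : α × β → Prop}
    (h : ∀ᵐ z ∂(μ.prod ν), p z) : ∀ᵐ y ∂ν, ∀ᵐ s ∂μ, p (s, y) := by
  have : ∀ᵐ z ∂(ν.prod μ), p (z.2, z.1) :=
    (Measure.measurePreserving_swap (μ := ν) (ν := μ)).quasiMeasurePreserving.ae h
  exact Measure.ae_ae_of_ae_prod this

/-- The space-time deformation distorts volumes at most as much as the deformations do. -/
lemma map_deformation_le {d : ℕ} {T : ℝ} {Ω S : Set (Vec d)} (hS : IsOpen S)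
    {x : ℝ → Vec d → Vec d} {c : ENNReal}
    (hle : ∀ t ∈ Icc 0 T, (volume.restrict S).map (x t) ≤ c • volume.restrict Ω)
    {y : ℝ × Vec d → Vec d} (hy : Measurable y)
    (hyx : ∀ t ∈ Icc 0 T, ∀ X ∈ S, y (t, X) = x t X) :
    ((volume.restrict (Ioc 0 T)).prod (volume.restrict S)).map (fun z => (z.1, y z)) ≤
      c • (volume.restrict (Ioc 0 T)).prod (volume.restrict Ω) := by
  refine map_prod_restrict_le hy ?_
  filter_upwards [ae_restrict_mem measurableSet_Ioc] with t ht
  have hyae : (fun X => y (t, X)) =ᵐ[volume.restrict S] x t := by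
    filter_upwards [ae_restrict_mem hS.measurableSet] with X hX
      using hyx t (Ioc_subset_Icc_self ht) X hX
  rw [Measure.map_congr hyae]
  exact hle t (Ioc_subset_Icc_self ht)

/-- The columns of the deformation gradient are weakly differentiable in time, with derivative
`∇u(x) F e`. -/
lemma hasTimeDeriv_fderiv_apply {d : ℕ} {T : ℝ} {Ω S : Set (Vec d)} (hT : 0 ≤ T)
    (hS : IsOpen S) (hSb : Bornology.IsBounded S) {x u : ℝ → Vec d → Vec d}
    {Du : ℝ → Vec d → Ten d} {K : ℝ≥0} (hx : ∀ t ∈ Icc 0 T, LipschitzOnWith K (x t) S)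
    {c : ENNReal} (hc : c ≠ ⊤)
    (hle : ∀ t ∈ Icc 0 T, (volume.restrict S).map (x t) ≤ c • volume.restrict Ω)
    (hxt : HasTimeDeriv T S x (fun t X => u t (x t X)))
    (hDu : MemLp (Function.uncurry Du) 2
      ((volume.restrict (Ioc 0 T)).prod (volume.restrict Ω)))
    (hu : ∀ᵐ t ∂(volume.restrict (Ioc 0 T)), MemH10 Ω (u t) (Du t)) {y : ℝ × Vec d → Vec d}
    (hy : Measurable y) (hyx : ∀ t ∈ Icc 0 T, ∀ X ∈ S, y (t, X) = x t X) {e : Vec d}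
    {L : ℝ → Vec d → Vec d} (hL : StronglyMeasurable (Function.uncurry L))
    (hLx : ∀ t ∈ Icc 0 T, ∀ᵐ X ∂(volume.restrict S), L t X = fderiv ℝ (x t) X e) :
    HasTimeDeriv T S (fun t X => fderiv ℝ (x t) X e) (fun t X => Du t (y (t, X)) (L t X)) := by
  have := isFiniteMeasure_restrict_of_isBounded hSb
  have h0 : (0 : ℝ) ∈ Icc 0 T := ⟨le_rfl, hT⟩
  have hF : ∀ t ∈ Icc 0 T, MemLp (fun X => fderiv ℝ (x t) X e) ⊤ (volume.restrict S) :=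
    fun t ht => (ContinuousLinearMap.apply ℝ (Vec d) e).comp_memLp'
      (memLp_fderiv_of_lipschitzOn hS (hx t ht))
  have hIoc : ∀ᵐ t ∂(volume.restrict (Ioc 0 T)), t ∈ Icc 0 T := by
    filter_upwards [ae_restrict_mem measurableSet_Ioc] with t ht using Ioc_subset_Icc_self ht
  have hyae : ∀ t ∈ Icc 0 T, (fun X => y (t, X)) =ᵐ[volume.restrict S] x t := fun t ht => by
    filter_upwards [ae_restrict_mem hS.measurableSet] with X hX using hyx t ht X hX
  have hprod := map_deformation_le hS hle hy hyx
  have hDuy : MemLp (fun z : ℝ × Vec d => Du z.1 (y z)) 2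
      ((volume.restrict (Ioc 0 T)).prod (volume.restrict S)) := by
    have := hDu.comp_of_map_le (x := fun z : ℝ × Vec d => (z.1, y z))
      (measurable_fst.prodMk hy).aemeasurable hc hprod
    exact this
  have hLb : ∀ᵐ z ∂((volume.restrict (Ioc 0 T)).prod (volume.restrict S)),
      ‖L z.1 z.2‖ ≤ K * ‖e‖ := by
    refine (Measure.ae_prod_mem_iff_ae_ae_mem (s := {z : ℝ × Vec d | ‖L z.1 z.2‖ ≤ K * ‖e‖})
      (measurableSet_le hL.measurable.norm measurable_const)).2 ?_
    filter_upwards [hIoc] with t ht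
    filter_upwards [hLx t ht, ae_restrict_mem hS.measurableSet] with X hX hXS
    rw [hX]
    refine (ContinuousLinearMap.le_opNorm _ _).trans ?_
    gcongr
    exact norm_fderiv_le_of_lipschitzOn ℝ (hS.mem_nhds hXS) (hx t ht)
  have hG : MemLp (Function.uncurry fun t X => Du t (y (t, X)) (L t X)) 2
      ((volume.restrict (Ioc 0 T)).prod (volume.restrict S)) := by
    refine hDuy.of_le_mul (c := K * ‖e‖)
      (aestronglyMeasurable_ten_apply hDuy.1 hL.aestronglyMeasurable) ?_
    filter_upwards [hLb] with z hz
    refine (ContinuousLinearMap.le_opNorm _ _).trans ?_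
    rw [mul_comm]
    gcongr
  refine ⟨(hF 0 h0).mono_exponent le_top, hG, fun t ht => ?_⟩
  have hG1 := (integral_smul_intervalIntegral ht hG (c := fun _ => (1 : ℝ)) (memLp_const _)).1
  simp only [one_smul] at hG1
  -- The formula `x(t) = x(0) + ∫ u ∘ x` is differentiated weakly in space: the derivative is moved
  -- onto `φ`, Fubini extracts the time integral, and at a.e. time the chain rule for `u(s) ∘ x(s)`
  -- moves the derivative back.
  refine ae_eq_of_forall_integral_smul_eq hS ((hF t ht).integrable le_top)
    (((hF 0 h0).integrable le_top).add hG1) fun φ hφ hφc hφS => ?_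
  have hφ1 : ContDiff ℝ 1 φ := hφ.of_le (by exact_mod_cast le_top)
  have hDφ : MemLp (fun X => fderiv ℝ φ X e) 2 (volume.restrict S) :=
    ((hφ1.continuous_fderiv (by norm_num)).clm_apply continuous_const).memLp_of_hasCompactSupport
      (hφc.fderiv_apply ℝ e)
  have hφL : MemLp φ 2 (volume.restrict S) := hφ.continuous.memLp_of_hasCompactSupport hφc
  have hwg : ∀ s ∈ Icc 0 T, ∫ X in S, φ X • fderiv ℝ (x s) X e =
      - ∫ X in S, (fderiv ℝ φ X e) • x s X := fun s hs => by
    rw [(hasWeakGrad_fderiv_of_lipschitzOn hS hSb (hx s hs)).2.2 φ hφ hφc hφS e, neg_neg]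
  obtain ⟨hi1, hi2⟩ := integral_smul_intervalIntegral ht hxt.memLp_deriv hDφ
  obtain ⟨hj1, hj2⟩ := integral_smul_intervalIntegral ht hG hφL
  have hi0 : Integrable (fun X => (fderiv ℝ φ X e) • x 0 X) (volume.restrict S) :=
    memLp_one_iff_integrable.1 (hxt.memLp_init.smul hDφ)
  have hj0 : Integrable (fun X => φ X • fderiv ℝ (x 0) X e) (volume.restrict S) :=
    memLp_one_iff_integrable.1 (((hF 0 h0).mono_exponent (p := 2) le_top).smul hφL)
  have hxI : ∫ X in S, (fderiv ℝ φ X e) • x t X =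
      (∫ X in S, (fderiv ℝ φ X e) • x 0 X) +
        ∫ X in S, (fderiv ℝ φ X e) • ∫ s in (0 : ℝ)..t, u s (x s X) := by
    rw [← integral_add hi0 hi1]
    refine integral_congr_ae ?_
    filter_upwards [hxt.eq_add_integral t ht] with X hX
    rw [hX, smul_add]
  simp only [smul_add]
  rw [hwg t ht, hxI, integral_add hj0 hj1, hwg 0 h0, hi2, hj2, neg_add, add_right_inj,
    ← intervalIntegral.integral_neg, intervalIntegral.integral_of_le ht.1,
    intervalIntegral.integral_of_le ht.1]
  refine integral_congr_ae ?_
  filter_upwards [ae_restrict_of_ae_restrict_of_subset (Ioc_subset_Ioc_right ht.2) hu,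
    ae_restrict_of_ae_restrict_of_subset (Ioc_subset_Ioc_right ht.2) hIoc] with s hs hsT
  rw [(hs.hasWeakGrad_comp hS hSb (hx s hsT) hc (hle s hsT)).2.2 φ hφ hφc hφS e, neg_neg]
  refine integral_congr_ae ?_
  filter_upwards [hLx s hsT, hyae s hsT] with X h1 h2
  rw [h1, h2]
  rfl

end Kinematics

/-! ### Liouville's formula and conservation of volume. -/

section Determinant

lemma det_eq_matrix_det {d : ℕ} (A : Ten d) :
    A.det = Matrix.det (Matrix.of fun i j => (A (EuclideanSpace.single j 1)) i) := by
  rw [ContinuousLinearMap.det, ← LinearMap.det_toMatrix (EuclideanSpace.basisFun (Fin d) ℝ).toBasis]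
  rfl

lemma ten_apply_apply {d : ℕ} (A : Ten d) (w : Vec d) (i : Fin d) :
    (A w) i = ∑ k, (A (EuclideanSpace.single k 1)) i * w k := by
  conv_lhs => rw [← (EuclideanSpace.basisFun (Fin d) ℝ).sum_repr w]
  simp [mul_comm]

/-- Liouville's formula in dimensions two and three: the determinant is constant along solutions of
a linear system with trace free coefficients. -/
lemma det_primitive_eq {d : ℕ} (hd : d = 2 ∨ d = 3) {t : ℝ} (ht : 0 ≤ t)
    {g : Fin d → ℝ → Vec d} {a : Fin d → Vec d} {A : ℝ → Ten d}
    (hg : ∀ j, IntervalIntegrable (g j) volume 0 t)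
    (hA : ∀ j, ∀ᵐ s ∂(volume.restrict (Ioc 0 t)), g j s = A s (a j + ∫ r in (0 : ℝ)..s, g j r))
    (htr : ∀ᵐ s ∂(volume.restrict (Ioc 0 t)), tr (A s) = 0) :
    Matrix.det (Matrix.of fun i j => (a j + ∫ r in (0 : ℝ)..t, g j r) i) =
      Matrix.det (Matrix.of fun i j => a j i) := by
  set f : Fin d → Fin d → ℝ → ℝ := fun i j s => a j i + ∫ r in (0 : ℝ)..s, g j r i
  have hac : ∀ i j, AbsolutelyContinuousOnInterval (f i j) 0 t := fun i j =>
    absolutelyContinuousOnInterval_const_add_primitive ((hg j).euclidean_apply i) _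
  have hfs : ∀ s ∈ Icc 0 t, ∀ i j, (a j + ∫ r in (0 : ℝ)..s, g j r) i = f i j s :=
    fun s hs i j => by
      simp only [f, PiLp.add_apply]
      rw [intervalIntegral_apply]
      exact (hg j).mono_set (by
        rw [uIcc_of_le hs.1, uIcc_of_le ht]; exact Icc_subset_Icc_right hs.2)
  have hder : ∀ᵐ s, s ∈ uIcc 0 t → tr (A s) = 0 ∧ ∀ i j,
      HasDerivAt (f i j) (∑ k, (A s (EuclideanSpace.single k 1)) i * f k j s) s := by
    have h1 : ∀ᵐ s, ∀ i j, s ∈ uIcc 0 t → HasDerivAt (f i j) (g j s i) s := by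
      simp only [ae_all_iff]
      exact fun i j => ae_hasDerivAt_const_add_primitive ((hg j).euclidean_apply i) _
    have h2 := fun j => (ae_restrict_iff' measurableSet_Ioc).1 (hA j)
    -- The system is known on `(0, t]` only, so the endpoint `0` of `uIcc 0 t` is discarded as a
    -- null set.
    filter_upwards [h1, ae_all_iff.2 h2, (ae_restrict_iff' measurableSet_Ioc).1 htr,
      compl_mem_ae_iff.2 (measure_singleton (μ := volume) (0 : ℝ))] with s h1 h2 h3 h0 hs
    rw [uIcc_of_le ht] at hs
    have hs0 : s ≠ 0 := h0
    have hs' : s ∈ Ioc 0 t := ⟨lt_of_le_of_ne hs.1 hs0.symm, hs.2⟩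
    refine ⟨h3 hs', fun i j => ?_⟩
    have h4 := h1 i j (by rwa [uIcc_of_le ht])
    rw [h2 j hs', ten_apply_apply] at h4
    simpa only [hfs s hs] using h4
  -- `D` will be the expanded determinant; both dimensions share the conclusion that an absolutely
  -- continuous function with a.e. zero derivative is constant.
  have hconst : ∀ D : ℝ → ℝ, (∀ s ∈ Icc 0 t,
        D s = Matrix.det (Matrix.of fun i j => (a j + ∫ r in (0 : ℝ)..s, g j r) i)) →
      AbsolutelyContinuousOnInterval D 0 t → (∀ᵐ s, s ∈ uIcc 0 t → HasDerivAt D 0 s) →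
      Matrix.det (Matrix.of fun i j => (a j + ∫ r in (0 : ℝ)..t, g j r) i) =
      Matrix.det (Matrix.of fun i j => a j i) := by
    intro D hD hDac hD'
    obtain ⟨C, hC⟩ := hDac.const_of_ae_hasDerivAt_zero hD'
    have h1 := hC t (by simp)
    have h2 := hC 0 (by simp)
    rw [hD t ⟨ht, le_rfl⟩] at h1
    rw [hD 0 ⟨le_rfl, ht⟩] at h2
    simp only [intervalIntegral.integral_same, add_zero] at h2
    rw [h1, h2]
  rcases hd with rfl | rfl
  · refine hconst (fun s => f 0 0 s * f 1 1 s - f 0 1 s * f 1 0 s) (fun s hs => ?_)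
      (((hac 0 0).fun_mul (hac 1 1)).sub ((hac 0 1).fun_mul (hac 1 0))) ?_
    · simp only [Matrix.det_fin_two, Matrix.of_apply, hfs s hs]
    · filter_upwards [hder] with s hs hst
      obtain ⟨h0, h⟩ := hs hst
      have := ((h 0 0).mul (h 1 1)).sub ((h 0 1).mul (h 1 0))
      refine this.congr_deriv ?_
      rw [tr_eq_sum] at h0
      simp only [Fin.sum_univ_two] at h0 ⊢
      -- The derivative of the determinant is the determinant times the trace of `A s`.
      linear_combination (f 0 0 s * f 1 1 s - f 0 1 s * f 1 0 s) * h0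
  · refine hconst (fun s => f 0 0 s * (f 1 1 s * f 2 2 s - f 1 2 s * f 2 1 s)
        - f 0 1 s * (f 1 0 s * f 2 2 s - f 1 2 s * f 2 0 s)
        + f 0 2 s * (f 1 0 s * f 2 1 s - f 1 1 s * f 2 0 s)) (fun s hs => ?_)
      ((((hac 0 0).fun_mul (((hac 1 1).fun_mul (hac 2 2)).sub ((hac 1 2).fun_mul (hac 2 1)))).sub
        ((hac 0 1).fun_mul (((hac 1 0).fun_mul (hac 2 2)).sub ((hac 1 2).fun_mul (hac 2 0))))).add
        ((hac 0 2).fun_mul (((hac 1 0).fun_mul (hac 2 1)).sub ((hac 1 1).fun_mul (hac 2 0))))) ?_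
    · simp only [Matrix.det_fin_three, Matrix.of_apply, hfs s hs]
      ring
    · filter_upwards [hder] with s hs hst
      obtain ⟨h0, h⟩ := hs hst
      have := (((h 0 0).mul (((h 1 1).mul (h 2 2)).sub ((h 1 2).mul (h 2 1)))).sub
        ((h 0 1).mul (((h 1 0).mul (h 2 2)).sub ((h 1 2).mul (h 2 0))))).add
        ((h 0 2).mul (((h 1 0).mul (h 2 1)).sub ((h 1 1).mul (h 2 0))))
      refine this.congr_deriv ?_
      rw [tr_eq_sum] at h0
      simp only [Fin.sum_univ_three, Pi.sub_apply, Pi.mul_apply] at h0 ⊢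
      linear_combination (f 0 0 s * (f 1 1 s * f 2 2 s - f 1 2 s * f 2 1 s)
        - f 0 1 s * (f 1 0 s * f 2 2 s - f 1 2 s * f 2 0 s)
        + f 0 2 s * (f 1 0 s * f 2 1 s - f 1 1 s * f 2 0 s)) * h0

/-- A family of tensors whose columns evolve with a trace free rate has constant determinant. -/
lemma ae_det_eq_of_hasTimeDeriv {d : ℕ} (hd : d = 2 ∨ d = 3) {T : ℝ} {S : Set (Vec d)}
    {F : ℝ → Vec d → Ten d} {A : ℝ × Vec d → Ten d} {L : Fin d → ℝ → Vec d → Vec d}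
    (hF : ∀ j, HasTimeDeriv T S (fun t X => F t X (EuclideanSpace.single j 1))
      (fun t X => A (t, X) (L j t X)))
    (hL : ∀ j, StronglyMeasurable (Function.uncurry (L j)))
    (hLF : ∀ j, ∀ t ∈ Icc 0 T, ∀ᵐ X ∂(volume.restrict S),
      L j t X = F t X (EuclideanSpace.single j 1))
    (hA : ∀ᵐ z ∂((volume.restrict (Ioc 0 T)).prod (volume.restrict S)), tr (A z) = 0)
    {t : ℝ} (ht : t ∈ Icc 0 T) :
    ∀ᵐ X ∂(volume.restrict S), (F t X).det = (F 0 X).det := by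
  have hT : 0 ≤ T := ht.1.trans ht.2
  choose w hwm _ _ hwF hw using fun j => (hF j).exists_primitive hT
  -- At each time `L` and `w` agree at a.e. `X`. Fubini exchanges the quantifiers, so at a.e. fixed
  -- `X` the columns `w` solve a linear ordinary differential equation.
  have hLw : ∀ j, ∀ᵐ X ∂(volume.restrict S), ∀ᵐ s ∂(volume.restrict (Ioc 0 T)),
      L j s X = w j s X := fun j => by
    refine ae_ae_swap_of_ae_prod (p := fun z => L j z.1 z.2 = w j z.1 z.2)
      (ae_prod_eq_of_ae_ae_eq (hL j).aestronglyMeasurable (hwm j).aestronglyMeasurable ?_)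
    filter_upwards [ae_restrict_mem measurableSet_Ioc] with s hs
    filter_upwards [hLF j s (Ioc_subset_Icc_self hs), hwF j s (Ioc_subset_Icc_self hs)]
      with X h1 h2
    exact h1.trans h2
  have hsub : Ioc 0 t ⊆ Ioc 0 T := Ioc_subset_Ioc_right ht.2
  filter_upwards [ae_all_iff.2 hLw, ae_all_iff.2 hw, ae_all_iff.2 fun j => hwF j t ht,
    ae_all_iff.2 fun j => hwF j 0 ⟨le_rfl, hT⟩, ae_ae_swap_of_ae_prod hA]
    with X h1 h2 h3 h4 h5
  have key := det_primitive_eq hd ht.1 (g := fun j s => A (s, X) (L j s X))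
    (a := fun j => w j 0 X) (A := fun s => A (s, X))
    (fun j => (h2 j).1.mono_set (by
      rw [uIcc_of_le ht.1, uIcc_of_le hT]; exact Icc_subset_Icc_right ht.2))
    (fun j => by
      filter_upwards [ae_restrict_of_ae_restrict_of_subset hsub (h1 j),
        ae_restrict_mem measurableSet_Ioc] with s hs hst
      rw [← (h2 j).2 s (Ioc_subset_Icc_self (hsub hst)), hs])
    (ae_restrict_of_ae_restrict_of_subset hsub h5)
  rw [det_eq_matrix_det, det_eq_matrix_det]
  simp only [h3, h4]
  simp only [fun j => (h2 j).2 t ht]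
  exact key

end Determinant

/-! ### Integrability of the dissipation and of the elastic energy. -/

section Energy

open Filter Topology

/-- `tr (F Fᵀ) = tr (Fᵀ F)` is the sum of the squared column norms, and the columns are what the
kinematic equation evolves. -/
lemma neoHookean_eq {d : ℕ} (c₁ : ℝ) (F : Ten d) :
    neoHookean c₁ F = c₁ / 2 * ((∑ j, ‖F (EuclideanSpace.single j 1)‖ ^ 2) - d)
      - c₁ * Real.log F.det := by
  have h : tr (F ∘L ContinuousLinearMap.adjoint F) =
      ∑ j, ‖F (EuclideanSpace.single j 1)‖ ^ 2 := by
    have h1 : tr (F ∘L ContinuousLinearMap.adjoint F) =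
        tr (ContinuousLinearMap.adjoint F ∘L F) := LinearMap.trace_mul_comm ℝ _ _
    rw [h1, tr, LinearMap.trace_eq_sum_inner _ (EuclideanSpace.basisFun (Fin d) ℝ)]
    refine Finset.sum_congr rfl fun j _ => ?_
    simp only [EuclideanSpace.basisFun_apply, ContinuousLinearMap.coe_coe,
      ContinuousLinearMap.comp_apply, ContinuousLinearMap.adjoint_inner_right,
      real_inner_self_eq_norm_sq]
  rw [neoHookean, h]

lemma continuous_symGrad {d : ℕ} : Continuous (symGrad : Ten d → Ten d) :=
  continuous_id.add ContinuousLinearMap.adjoint.continuous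

lemma norm_symGrad_le {d : ℕ} (A : Ten d) : ‖symGrad A‖ ≤ 2 * ‖A‖ := by
  refine (norm_add_le _ _).trans (le_of_eq ?_)
  rw [LinearIsometryEquiv.norm_map, two_mul]

lemma memLp_tr {α : Type*} [MeasurableSpace α] {μ : Measure α} {d : ℕ} {A : α → Ten d}
    (hA : MemLp A 2 μ) : MemLp (fun y => tr (A y)) 2 μ := by
  simp only [tr_eq_sum]
  exact memLp_finsetSum _ fun j _ => (EuclideanSpace.proj (𝕜 := ℝ) j).comp_memLp'
    ((ContinuousLinearMap.apply ℝ (Vec d) (EuclideanSpace.single j (1 : ℝ))).comp_memLp' hA)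

lemma integrable_dissipation {α : Type*} [MeasurableSpace α] {μ : Measure α} {d : ℕ}
    {A : α → Ten d} (hA : MemLp A 2 μ) :
    Integrable (fun y => ddot (symGrad (A y)) (symGrad (A y))) μ := by
  have h1 : MemLp (fun y => symGrad (A y)) 2 μ :=
    hA.of_le_mul (continuous_symGrad.comp_aestronglyMeasurable hA.1)
      (Eventually.of_forall fun y => norm_symGrad_le _)
  have h2 : ∀ j : Fin d, MemLp (fun y => symGrad (A y) (EuclideanSpace.single j 1)) 2 μ :=
    fun j => (ContinuousLinearMap.apply ℝ (Vec d) (EuclideanSpace.single j (1 : ℝ))).comp_memLp' h1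
  exact integrable_finsetSum _ fun j _ => integrable_inner_of_memLp_two (h2 j) (h2 j)

lemma memLp_two_slice {α β E : Type*} [MeasurableSpace α] [MeasurableSpace β]
    [NormedAddCommGroup E] {μ : Measure α} {ν : Measure β} [SFinite μ] [SFinite ν]
    {h : α → β → E} (hh : MemLp (Function.uncurry h) 2 (μ.prod ν)) :
    ∀ᵐ s ∂μ, MemLp (h s) 2 ν := by
  have h1 := ((memLp_two_iff_integrable_sq_norm hh.1).1 hh).prod_right_ae
  filter_upwards [hh.1.prodMk_left, h1] with s hs1 hs2
  exact (memLp_two_iff_integrable_sq_norm hs1).2 hs2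

/-- The logarithm of the Jacobian of a bi-Lipschitz map is bounded. -/
lemma exists_abs_log_det_le (d : ℕ) (K : ℝ≥0) : ∃ M : ℝ, ∀ A : Ten d, ‖A‖ ≤ K →
    (∀ v, ‖v‖ ≤ K * ‖A v‖) → |Real.log A.det| ≤ M := by
  -- The two bounds cut out a compact set of invertible tensors, on which the logarithm of the
  -- determinant is continuous.
  set s : Set (Ten d) := Metric.closedBall 0 K ∩ ⋂ v : Vec d, {A | ‖v‖ ≤ K * ‖A v‖}
  have hs : IsCompact s := by
    refine (isCompact_closedBall _ _).inter_right (isClosed_iInter fun v => ?_)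
    exact isClosed_le continuous_const (by fun_prop)
  have hdet : ∀ A ∈ s, A.det ≠ 0 := by
    intro A hA h0
    obtain ⟨v, hv, hv0⟩ := Submodule.exists_mem_ne_zero_of_ne_bot
      (LinearMap.bot_lt_ker_of_det_eq_zero (f := (A : Vec d →ₗ[ℝ] Vec d)) h0).ne'
    have h1 : ‖v‖ ≤ K * ‖A v‖ := mem_iInter.1 hA.2 v
    have h2 : A v = 0 := hv
    rw [h2, norm_zero, mul_zero] at h1
    exact hv0 (norm_le_zero_iff.1 h1)
  have hc : ContinuousOn (fun A : Ten d => Real.log A.det) s :=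
    ContinuousOn.log ContinuousLinearMap.continuous_det.continuousOn hdet
  obtain ⟨M, hM⟩ := hs.exists_bound_of_continuousOn hc
  refine ⟨M, fun A hA hv => hM A ⟨by simpa using hA, mem_iInter.2 hv⟩⟩

/-- At a point of differentiability both Lipschitz bounds pass to the derivative, the lower one
through difference quotients; hence the integrand is a.e. bounded on a set of finite measure. -/
lemma integrable_log_det_fderiv {d : ℕ} {S : Set (Vec d)} (hS : IsOpen S)
    (hSb : Bornology.IsBounded S) {g : Vec d → Vec d} {K : ℝ≥0} (hg : LipschitzOnWith K g S)
    (hg' : ∀ X ∈ S, ∀ Y ∈ S, dist X Y ≤ K * dist (g X) (g Y)) :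
    Integrable (fun X => Real.log (fderiv ℝ g X).det) (volume.restrict S) := by
  have := isFiniteMeasure_restrict_of_isBounded hSb
  obtain ⟨M, hM⟩ := exists_abs_log_det_le d K
  refine Integrable.of_bound (Real.measurable_log.comp
    (ContinuousLinearMap.continuous_det.measurable.comp
      (measurable_fderiv ℝ g))).aestronglyMeasurable M ?_
  filter_upwards [hg.ae_differentiableAt_of_isOpen hS, ae_restrict_mem hS.measurableSet]
    with X hX hXS
  refine hM _ (norm_fderiv_le_of_lipschitzOn ℝ (hS.mem_nhds hXS) hg) fun v => ?_
  have hc : Tendsto (fun n : ℕ => ‖(n : ℝ) + 1‖) atTop atTop := by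
    refine (tendsto_atTop_add_const_right _ 1 tendsto_natCast_atTop_atTop).congr fun n => ?_
    rw [Real.norm_of_nonneg (by positivity)]
  have hlim := (hX.hasFDerivAt.lim v hc).norm.const_mul (K : ℝ)
  have h0 : Tendsto (fun n : ℕ => X + ((n : ℝ) + 1)⁻¹ • v) atTop (𝓝 X) := by
    have h1 : Tendsto (fun n : ℕ => ((n : ℝ) + 1)⁻¹) atTop (𝓝 0) :=
      tendsto_inv_atTop_zero.comp
        (tendsto_atTop_add_const_right _ 1 tendsto_natCast_atTop_atTop)
    simpa using tendsto_const_nhds.add (h1.smul_const v)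
  refine ge_of_tendsto hlim ?_
  filter_upwards [h0.eventually (hS.mem_nhds hXS)] with n hn
  have h2 := hg' _ hn X hXS
  rw [dist_eq_norm, dist_eq_norm, add_sub_cancel_left, norm_smul, norm_inv] at h2
  have hpos : 0 < ‖(n : ℝ) + 1‖ := by rw [Real.norm_of_nonneg] <;> positivity
  rw [norm_smul]
  calc ‖v‖ = ‖(n : ℝ) + 1‖ * (‖(n : ℝ) + 1‖⁻¹ * ‖v‖) := by field_simp
    _ ≤ ‖(n : ℝ) + 1‖ * (K * ‖g (X + ((n : ℝ) + 1)⁻¹ • v) - g X‖) := by gcongr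
    _ = _ := by ring

end Energy

/-! ### Consequences of the weak formulation. -/

section EnergyBalance

open Filter Topology

variable {d : ℕ} {P : FSIProblem d} {u : ℝ → Vec d → Vec d} {Du : ℝ → Vec d → Ten d}
  {ut : ℝ → Vec d → Vec d} {p : ℝ → Vec d → ℝ} {x : ℝ → Vec d → Vec d} {Ut : ℝ → Vec d → Vec d}

lemma FSIProblem.IsWeakSolution.exists_map_le (h : P.IsWeakSolution u Du ut p x Ut) :
    ∃ c : ENNReal, c ≠ ⊤ ∧ ∀ t ∈ Icc 0 P.T,
      (volume.restrict P.S).map (x t) ≤ c • volume.restrict P.Ω := by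
  obtain ⟨K, hK⟩ := h.biLipschitz_x
  exact ⟨(K : ENNReal) ^ d, by simp, fun t ht =>
    map_restrict_le_of_biLipschitz P.isOpen_S.measurableSet (hK t ht).1.continuousOn
      (h.mapsTo_x t ht) (hK t ht).2⟩

/-- The velocity is divergence free at almost every time. -/
lemma FSIProblem.IsWeakSolution.ae_tr_eq_zero (h : P.IsWeakSolution u Du ut p x Ut) :
    ∀ᵐ s ∂(volume.restrict (Ioc 0 P.T)), ∀ᵐ y ∂(volume.restrict P.Ω), tr (Du s y) = 0 := by
  filter_upwards [h.memH10_u, h.continuity_eq] with s hs hc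
  have hL := memLp_tr hs.1.2.1
  -- The divergence itself is the test function `q`.
  have h0 := neg_eq_zero.1 (hc _ hL)
  have hsq : Integrable (fun y => tr (Du s y) * tr (Du s y)) (volume.restrict P.Ω) := by
    simpa only [sq] using hL.integrable_sq
  filter_upwards [(integral_eq_zero_iff_of_nonneg (fun y => mul_self_nonneg _) hsq).1 h0] with y hy
  exact mul_self_eq_zero.1 hy

/-- The momentum equation tested with the velocity itself. -/
lemma FSIProblem.IsWeakSolution.momentum_self (hd : d = 2 ∨ d = 3)
    (h : P.IsWeakSolution u Du ut p x Ut) :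
    ∀ᵐ s ∂(volume.restrict (Ioc 0 P.T)),
      P.ρf * (∫ y in P.Ω, inner ℝ (ut s y) (u s y))
        + P.μf / 2 * (∫ y in P.Ω, ddot (symGrad (Du s y)) (symGrad (Du s y)))
        + P.ρδ * (∫ X in P.S, inner ℝ (Ut s X) (u s (x s X)))
        + P.c₁ * (∫ X in P.S, ddot (fderiv ℝ (x s) X) (Du s (x s X) ∘L fderiv ℝ (x s) X)) = 0 := by
  obtain ⟨K, hK⟩ := h.biLipschitz_x
  obtain ⟨c, hc, hle⟩ := h.exists_map_le
  filter_upwards [h.memH10_u, h.momentum_eq, h.ae_tr_eq_zero, ae_restrict_mem measurableSet_Ioc]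
    with s hu hm hdiv hs
  have hs' := Ioc_subset_Icc_self hs
  -- The chain rule supplies `Du(x) F` as the reference gradient of `u ∘ x`.
  have key := hm (u s) (Du s) hu _
    (hu.hasWeakGrad_comp P.isOpen_S P.isBounded_S (hK s hs').1 hc (hle s hs'))
  have h1 : ∫ y in P.Ω, inner ℝ (Du s y (u s y)) (u s y) = 0 :=
    integral_convection_self_eq_zero hd P.isBounded_Ω hu hdiv
  have h2 : ∫ y in P.Ω, p s y * tr (Du s y) = 0 :=
    integral_eq_zero_of_ae (hdiv.mono fun y hy => by simp [hy])
  have h3 : ∫ y in x s '' P.S,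
      (fderiv ℝ (x s) (Function.invFunOn (x s) P.S y)).det⁻¹ * tr (Du s y) = 0 := by
    refine integral_eq_zero_of_ae ?_
    filter_upwards [ae_restrict_of_ae_restrict_of_subset (h.mapsTo_x s hs').image_subset hdiv]
      with y hy
    simp [hy]
  rw [FSIProblem.momentum, h1, h2, h3] at key
  linarith

/-- The gradient part of the elastic energy changes by the work of the elastic stress, and the
volume is preserved. -/
lemma FSIProblem.IsWeakSolution.elastic_energy (hd : d = 2 ∨ d = 3)
    (h : P.IsWeakSolution u Du ut p x Ut) {t : ℝ} (ht : t ∈ Icc 0 P.T) :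
    (∀ j : Fin d, Integrable (fun X => ‖fderiv ℝ (x t) X (EuclideanSpace.single j 1)‖ ^ 2)
      (volume.restrict P.S)) ∧
    IntervalIntegrable (fun s => ∫ X in P.S,
      ddot (fderiv ℝ (x s) X) (Du s (x s X) ∘L fderiv ℝ (x s) X)) volume 0 t ∧
    ∫ s in (0 : ℝ)..t, ∫ X in P.S, ddot (fderiv ℝ (x s) X) (Du s (x s X) ∘L fderiv ℝ (x s) X) =
      ∑ j : Fin d, ((∫ X in P.S, ‖fderiv ℝ (x t) X (EuclideanSpace.single j 1)‖ ^ 2)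
        - ∫ X in P.S, ‖fderiv ℝ (x 0) X (EuclideanSpace.single j 1)‖ ^ 2) / 2 ∧
    ∀ᵐ X ∂(volume.restrict P.S), (fderiv ℝ (x t) X).det = (fderiv ℝ (x 0) X).det := by
  have hT := P.T_pos.le
  obtain ⟨K, hK⟩ := h.biLipschitz_x
  obtain ⟨c, hc, hle⟩ := h.exists_map_le
  have hx : ∀ t ∈ Icc 0 P.T, LipschitzOnWith K (x t) P.S := fun t ht => (hK t ht).1
  have hcont := continuousOn_uncurry_of_hasTimeDeriv h.timeDeriv_x hT P.isOpen_S hx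
  set y := (Icc 0 P.T ×ˢ P.S).indicator (Function.uncurry x)
  have hy : Measurable y := measurable_indicator_of_continuousOn
    (measurableSet_Icc.prod P.isOpen_S.measurableSet) hcont
  have hyx : ∀ t ∈ Icc 0 P.T, ∀ X ∈ P.S, y (t, X) = x t X := fun s hs X hX =>
    indicator_of_mem (mk_mem_prod hs hX) _
  choose L hL hLx using fun j : Fin d =>
    exists_stronglyMeasurable_fderiv_apply P.isOpen_S hx hcont (EuclideanSpace.single j 1)
  -- Pairing `∂ₜ(F eⱼ) = ∇u F eⱼ` with `F eⱼ` and summing over `j` gives the elastic work, so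
  -- `HasTimeDeriv.energy` is applied to each column.
  have hcol := fun j => hasTimeDeriv_fderiv_apply hT P.isOpen_S P.isBounded_S hx hc hle
    h.timeDeriv_x h.memLp_Du h.memH10_u hy hyx (hL j) (hLx j)
  have hen := fun j => (hcol j).energy ht
  have hddot : ∀ᵐ s ∂(volume.restrict (Ioc 0 P.T)),
      ∑ j, ∫ X in P.S, inner ℝ (Du s (y (s, X)) (L j s X))
        (fderiv ℝ (x s) X (EuclideanSpace.single j 1)) =
      ∫ X in P.S, ddot (fderiv ℝ (x s) X) (Du s (x s X) ∘L fderiv ℝ (x s) X) := by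
    filter_upwards [ae_all_iff.2 fun j => memLp_two_slice (hcol j).memLp_deriv,
      ae_restrict_mem measurableSet_Ioc] with s hs hsT
    have hs' := Ioc_subset_Icc_self hsT
    rw [← integral_finsetSum _ fun j _ =>
      integrable_inner_of_memLp_two (hs j) ((hcol j).energy hs').1]
    refine integral_congr_ae ?_
    filter_upwards [ae_all_iff.2 fun j => hLx j s hs',
      ae_restrict_mem P.isOpen_S.measurableSet] with X hX hXS
    rw [ddot]
    refine Finset.sum_congr rfl fun j _ => ?_
    rw [hX j, hyx s hs' X hXS, real_inner_comm]
    rfl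
  have hddot' : ∀ᵐ s ∂(volume.restrict (Ioc 0 t)), _ :=
    ae_restrict_of_ae_restrict_of_subset (Ioc_subset_Ioc_right ht.2) hddot
  refine ⟨fun j => (hen j).1.integrable_norm_pow (by norm_num), ?_, ?_, ?_⟩
  · have h1 := IntervalIntegrable.sum Finset.univ fun j _ => (hen j).2.1
    rw [intervalIntegrable_iff_integrableOn_Ioc_of_le ht.1] at h1 ⊢
    refine h1.congr ?_
    filter_upwards [hddot'] with s hs
    rw [← hs, Finset.sum_apply]
  · rw [← Finset.sum_congr rfl fun j _ => (hen j).2.2,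
      ← intervalIntegral.integral_finsetSum fun j _ => (hen j).2.1,
      intervalIntegral.integral_of_le ht.1, intervalIntegral.integral_of_le ht.1]
    refine integral_congr_ae ?_
    filter_upwards [hddot'] with s hs using hs.symm
  · refine ae_det_eq_of_hasTimeDeriv hd (A := fun z => Du z.1 (y z)) hcol hL hLx ?_ ht
    have h0 : ∀ᵐ z ∂((volume.restrict (Ioc 0 P.T)).prod (volume.restrict P.Ω)),
        tr (Function.uncurry Du z) = 0 :=
      ae_prod_eq_of_ae_ae_eq (memLp_tr h.memLp_Du).1 aestronglyMeasurable_const h.ae_tr_eq_zero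
    exact ae_of_map_le (x := fun z : ℝ × Vec d => (z.1, y z))
      (measurable_fst.prodMk hy).aemeasurable (map_deformation_le P.isOpen_S hle hy hyx) h0

/-- Separates the column norms, whose change is the elastic work, from the two terms that do not
change in time. -/
lemma FSIProblem.IsWeakSolution.integral_neoHookean (hd : d = 2 ∨ d = 3)
    (h : P.IsWeakSolution u Du ut p x Ut) {t : ℝ} (ht : t ∈ Icc 0 P.T) :
    IntegrableOn (fun X => neoHookean P.c₁ (fderiv ℝ (x t) X)) P.S ∧
    ∫ X in P.S, neoHookean P.c₁ (fderiv ℝ (x t) X) =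
      P.c₁ / 2 * ((∑ j : Fin d, ∫ X in P.S, ‖fderiv ℝ (x t) X (EuclideanSpace.single j 1)‖ ^ 2)
        - volume.real P.S * d) - P.c₁ * ∫ X in P.S, Real.log (fderiv ℝ (x t) X).det := by
  have := isFiniteMeasure_restrict_of_isBounded P.isBounded_S
  obtain ⟨K, hK⟩ := h.biLipschitz_x
  have hlog := integrable_log_det_fderiv P.isOpen_S P.isBounded_S (hK t ht).1 (hK t ht).2
  have hF := (h.elastic_energy hd ht).1
  have hFs : Integrable (fun X => ∑ j : Fin d,
      ‖fderiv ℝ (x t) X (EuclideanSpace.single j 1)‖ ^ 2) (volume.restrict P.S) :=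
    integrable_finsetSum _ fun j _ => hF j
  have hI1 : Integrable (fun X => P.c₁ / 2 * ((∑ j : Fin d,
      ‖fderiv ℝ (x t) X (EuclideanSpace.single j 1)‖ ^ 2) - d)) (volume.restrict P.S) :=
    (hFs.sub (integrable_const (d : ℝ))).const_mul _
  have hI2 := hlog.const_mul P.c₁
  simp only [neoHookean_eq]
  refine ⟨hI1.sub hI2, ?_⟩
  rw [integral_sub hI1 hI2, integral_const_mul, integral_const_mul,
    integral_sub hFs (integrable_const (d : ℝ)), integral_finsetSum _ fun j _ => hF j,
    integral_const]
  simp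

end EnergyBalance

/-! ### The energy balance. -/

theorem mainTheorem1 {d : ℕ} (hd : d = 2 ∨ d = 3) (P : FSIProblem d)
    (u : ℝ → Vec d → Vec d) (Du : ℝ → Vec d → Ten d) (ut : ℝ → Vec d → Vec d)
    (p : ℝ → Vec d → ℝ) (x : ℝ → Vec d → Vec d) (Ut : ℝ → Vec d → Vec d)
    (h : P.IsWeakSolution u Du ut p x Ut) (t : ℝ) (ht : t ∈ Icc 0 P.T) :
    -- all the energies are finite
    IntegrableOn (fun y => ‖u t y‖ ^ 2) P.Ω ∧
    IntervalIntegrable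
      (fun s => ∫ y in P.Ω, ddot (symGrad (Du s y)) (symGrad (Du s y))) volume 0 t ∧
    IntegrableOn (fun X => ‖u t (x t X)‖ ^ 2) P.S ∧
    IntegrableOn (fun X => neoHookean P.c₁ (fderiv ℝ (x t) X)) P.S ∧
    -- the energy balance between the times `0` and `t`
    P.ρf / 2 * (∫ y in P.Ω, ‖u t y‖ ^ 2)
        + P.μf / 2 * (∫ s in (0 : ℝ)..t,
            ∫ y in P.Ω, ddot (symGrad (Du s y)) (symGrad (Du s y)))
        + P.ρδ / 2 * (∫ X in P.S, ‖u t (x t X)‖ ^ 2)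
        + (∫ X in P.S, neoHookean P.c₁ (fderiv ℝ (x t) X))
      = P.ρf / 2 * (∫ y in P.Ω, ‖P.u₀ y‖ ^ 2)
        + P.ρδ / 2 * (∫ X in P.S, ‖P.u₀ (P.x₀ X)‖ ^ 2)
        + (∫ X in P.S, neoHookean P.c₁ (fderiv ℝ P.x₀ X)) ∧
    -- the sum vanishes when the system starts at rest with the solid undeformed
    ((∀ᵐ y ∂(volume.restrict P.Ω), P.u₀ y = 0) →
      (∀ᵐ X ∂(volume.restrict P.S), fderiv ℝ P.x₀ X = ContinuousLinearMap.id ℝ (Vec d)) →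
      P.ρf / 2 * (∫ y in P.Ω, ‖u t y‖ ^ 2)
        + P.μf / 2 * (∫ s in (0 : ℝ)..t,
            ∫ y in P.Ω, ddot (symGrad (Du s y)) (symGrad (Du s y)))
        + P.ρδ / 2 * (∫ X in P.S, ‖u t (x t X)‖ ^ 2)
        + (∫ X in P.S, neoHookean P.c₁ (fderiv ℝ (x t) X)) = 0) := by
  have hT := P.T_pos.le
  have h0 : (0 : ℝ) ∈ Icc 0 P.T := ⟨le_rfl, hT⟩
  obtain ⟨K, hK⟩ := h.biLipschitz_x
  obtain ⟨c, hc, hle⟩ := h.exists_map_le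
  obtain ⟨hu1, hu2, hu3⟩ := h.timeDeriv_u.energy ht
  obtain ⟨hU1, hU2, hU3⟩ := h.timeDeriv_U.energy ht
  obtain ⟨-, hE2, hE3, hE4⟩ := h.elastic_energy hd ht
  obtain ⟨hn1, hn2⟩ := h.integral_neoHookean hd ht
  obtain ⟨-, hn0⟩ := h.integral_neoHookean hd h0
  have hdiss : IntervalIntegrable
      (fun s => ∫ y in P.Ω, ddot (symGrad (Du s y)) (symGrad (Du s y))) volume 0 t := by
    rw [intervalIntegrable_iff_integrableOn_Ioc_of_le ht.1]
    exact IntegrableOn.mono_set (integrable_dissipation h.memLp_Du).integral_prod_left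
      (Ioc_subset_Ioc_right ht.2)
  have hlog : ∫ X in P.S, Real.log (fderiv ℝ (x t) X).det =
      ∫ X in P.S, Real.log (fderiv ℝ (x 0) X).det :=
    integral_congr_ae (hE4.mono fun X hX => by simp only [hX])
  have hu0 : ∫ y in P.Ω, ‖u 0 y‖ ^ 2 = ∫ y in P.Ω, ‖P.u₀ y‖ ^ 2 :=
    integral_congr_ae (h.init_u.mono fun y hy => by simp only [hy])
  -- Facts about `u₀` hold only a.e. on `Ω`; they can be read at `x₀(X)` because preimages of null
  -- sets under the initial deformation are null.
  have hpull : ∀ {Q : Vec d → Prop}, (∀ᵐ y ∂(volume.restrict P.Ω), Q y) →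
      ∀ᵐ X ∂(volume.restrict P.S), Q (P.x₀ X) := fun hQ => by
    filter_upwards [ae_of_map_le ((hK 0 h0).1.continuousOn.aemeasurable P.isOpen_S.measurableSet)
      (hle 0 h0) hQ, ae_restrict_mem P.isOpen_S.measurableSet] with X hX hXS
    rwa [← h.init_x X hXS]
  have hU0 : ∫ X in P.S, ‖u 0 (x 0 X)‖ ^ 2 = ∫ X in P.S, ‖P.u₀ (P.x₀ X)‖ ^ 2 := by
    refine integral_congr_ae ?_
    filter_upwards [hpull h.init_u, ae_restrict_mem P.isOpen_S.measurableSet] with X hX hXS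
    rw [h.init_x X hXS, hX]
  have hF0 : ∀ X ∈ P.S, fderiv ℝ (x 0) X = fderiv ℝ P.x₀ X := fun X hX =>
    Filter.EventuallyEq.fderiv_eq (by
      filter_upwards [P.isOpen_S.mem_nhds hX] with Y hY using h.init_x Y hY)
  have hN0 : ∫ X in P.S, neoHookean P.c₁ (fderiv ℝ (x 0) X) =
      ∫ X in P.S, neoHookean P.c₁ (fderiv ℝ P.x₀ X) :=
    setIntegral_congr_fun P.isOpen_S.measurableSet fun X hX => by simp only [hF0 X hX]
  have hbal : ∫ s in (0 : ℝ)..t, (P.ρf * (∫ y in P.Ω, inner ℝ (ut s y) (u s y))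
        + P.μf / 2 * (∫ y in P.Ω, ddot (symGrad (Du s y)) (symGrad (Du s y)))
        + P.ρδ * (∫ X in P.S, inner ℝ (Ut s X) (u s (x s X)))
        + P.c₁ * (∫ X in P.S,
          ddot (fderiv ℝ (x s) X) (Du s (x s X) ∘L fderiv ℝ (x s) X))) = 0 := by
    rw [intervalIntegral.integral_of_le ht.1]
    exact integral_eq_zero_of_ae (ae_restrict_of_ae_restrict_of_subset
      (Ioc_subset_Ioc_right ht.2) (h.momentum_self hd))
  rw [intervalIntegral.integral_add (((hu2.const_mul _).add (hdiss.const_mul _)).add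
      (hU2.const_mul _)) (hE2.const_mul _),
    intervalIntegral.integral_add ((hu2.const_mul _).add (hdiss.const_mul _)) (hU2.const_mul _),
    intervalIntegral.integral_add (hu2.const_mul _) (hdiss.const_mul _),
    intervalIntegral.integral_const_mul, intervalIntegral.integral_const_mul,
    intervalIntegral.integral_const_mul, intervalIntegral.integral_const_mul,
    hu3, hU3, hE3, ← Finset.sum_div, Finset.sum_sub_distrib] at hbal
  have hmain : P.ρf / 2 * (∫ y in P.Ω, ‖u t y‖ ^ 2)
        + P.μf / 2 * (∫ s in (0 : ℝ)..t,
            ∫ y in P.Ω, ddot (symGrad (Du s y)) (symGrad (Du s y)))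
        + P.ρδ / 2 * (∫ X in P.S, ‖u t (x t X)‖ ^ 2)
        + (∫ X in P.S, neoHookean P.c₁ (fderiv ℝ (x t) X))
      = P.ρf / 2 * (∫ y in P.Ω, ‖P.u₀ y‖ ^ 2)
        + P.ρδ / 2 * (∫ X in P.S, ‖P.u₀ (P.x₀ X)‖ ^ 2)
        + (∫ X in P.S, neoHookean P.c₁ (fderiv ℝ P.x₀ X)) := by
    -- The volume and logarithm terms are now the same at both times and cancel; what remains is
    -- `hbal`.
    rw [← hu0, ← hU0, ← hN0, hn2, hn0, hlog]
    linarith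
  refine ⟨hu1.integrable_norm_pow (by norm_num), hdiss, hU1.integrable_norm_pow (by norm_num),
    hn1, hmain, fun hu₀ hF₀ => ?_⟩
  have z1 : ∫ y in P.Ω, ‖P.u₀ y‖ ^ 2 = 0 :=
    integral_eq_zero_of_ae (hu₀.mono fun y hy => by simp [hy])
  have z2 : ∫ X in P.S, ‖P.u₀ (P.x₀ X)‖ ^ 2 = 0 :=
    integral_eq_zero_of_ae ((hpull hu₀).mono fun X hX => by simp [hX])
  -- At the identity the squared column norms sum to `d` and the determinant is `1`.
  have z3 : ∫ X in P.S, neoHookean P.c₁ (fderiv ℝ P.x₀ X) = 0 :=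
    integral_eq_zero_of_ae (hF₀.mono fun X hX => by
      simp [hX, neoHookean_eq, ContinuousLinearMap.det])
  rw [hmain, z1, z2, z3]
  ring
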